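/- **Problem.** Let $t_0<t_f$, $I=[t_0,t_f]$, let $U\subset\mathbb R^{n_u}$ be nonempty and compact, $x_0\in\mathbb R^{n_x}$, let $q\ge 1$, and let $f:\mathbb R^{n_x}\times\mathbb R^{n_u}\to\mathbb R^{n_x}$ and $h:\mathbb R^{n_x}\times\mathbb R^{n_u}\to\mathbb R^{n_h}$ be $C^q$ and $\Phi:\mathbb R^{n_x}\to\mathbb R$ be $C^1$. For a control $u$ let $x(\cdot,u)$ be the solution on $I$ of $\dot x=f(x,u)$, $x(t_0)=x_0$, and write $h_i(u,t)=h_i(x(t,u),u)$, $J(u)=\Phi(x(t_f,u))$. The problem is to minimize $J(u)$ over $u\in U$ subject to $h_i(u,t)\le 0$ for all $t\in I$ and all $i$. **Upper bound.** Fix $r\ge q-1$, $\rho>0$ and intervals $[\Lambda_{L,i},\Lambda_{U,i}]$ containing $\partial_t^q h_i(u,t)$ for all $(u,t)\in U\times I$. Put $B_i=\max\{|\Lambda_{L,i}|,|\Lambda_{U,i}|\}$ if $q$ is odd, $B_i=\max\{0,\Lambda_{U,i}\}$ if $q$ is even, and $\delta=\ln(r+1)/\rho$. A cell $T$ is a closed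 subinterval of $I$ attached to a component $i=i(T)$ of the constraint, with midpoint $c(T)$ and length $\Delta(T)$. Let $\alpha_l(u,T)$ be the coefficients of the polynomial $\sum_{j<q}\frac{1}{j!}\partial_t^jh_i(u,c(T))\,[\Delta(T)(\tau-\frac12)]^j=\sum_l\alpha_l(u,T)\tau^l$, let $b_j(u,T)=\sum_{l=0}^{\min(j,q-1)}\alpha_l(u,T)\binom jl/\binom rl$ for $0\le j\le r$, and $$H_{TB}(u,T)=\frac1\rho\ln\Big(\sum_{j=0}^r e^{\rho b_j(u,T)}\Big)+\frac1{q!}\Big(\frac{\Delta(T)}2\Big)^qB_i .$$ **Algorithm.** Let $\epsilon_{stat},\epsilon_{act}>0$. Start with a finite set $\Pi^0$ of cells which, for each component $i$, subdivides $I$ into nondegenerate intervals. In iteration $k$ consider the approximation problem of minimizing $J(u)$ over $u\in U$ subject to $H_{TB}(u,T)\le0$ for all $T\in\Pi^k$. - If it is feasible, the solver returns a locally optimal $u^k$, a set $\Pi^k_{grad}\subseteq\Pi^k$ of at most $n_u$ cells (for instance $n_u$ cells with linearly independent gradients $\nabla_uH_{TB}(u^k,T)$) and multipliers $\lambda^k_T$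 ($T\in\Pi^k_{grad}$) that satisfy its KKT conditions $\nabla J(u^k)+\sum_{T\in\Pi^k_{grad}}\lambda^k_T\nabla_uH_{TB}(u^k,T)=0$ and $\lambda_T^kH_{TB}(u^k,T)=0$. The algorithm terminates and returns $u^k$ if $$\Big\|\nabla J(u^k)+\sum_{T\in\Pi^k_{grad}}\lambda^k_T\nabla_uh_{i(T)}(u^k,c(T))\Big\|\le\epsilon_{stat},\qquad(1)$$ $$\lambda_T^k\,h_{i(T)}(u^k,c(T))\in[-\lambda_T^k\epsilon_{act},0]\quad\text{for all }T\in\Pi^k_{grad},\qquad(2)$$ $$h_i(u^k,t)\le0\quad\text{for all }t\in I\text{ and all }i.\qquad(3)$$ Otherwise (Case 1) each $T\in\Pi^k_{grad}$ with $H_{TB}(u^k,T)=0$ is divided into $\max\big\{2,\big\lceil\Delta(T)/\sqrt[q]{2^q\,q!\,(\epsilon_{act}-\delta)/B_{i(T)}}\big\rceil\big\}$ equal parts (two parts if $B_{i(T)}=0$); the other cells are kept. - If it is infeasible (Case 2), every cell of $\Pi^k$ is bisected. **Theorem 2.** Assume 1. there is $K>0$ with $\|f(x,u)\|\le K(1+\|x\|)$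 for all $x\in\mathbb R^{n_x}$, $u\in U$; 2. there are $u_s\in U$ and $\gamma>0$ with $h_i(u_s,t)\le-\gamma$ for all $t\in I$ and all $i$; 3. in the run of the algorithm under consideration the multipliers $\lambda^k_T$ are nonnegative and bounded uniformly in all iterations; and let $\rho$ be so large that $\delta<\epsilon_{act}$ and $\delta<\gamma$. Then the algorithm terminates after finitely many iterations. The point $u^k\in U$ that it returns is feasible for the original path constraint on all of $I$, i.e. satisfies (3), and satisfies the approximate KKT conditions (1) and (2) of the original problem with the nonnegative multipliers $\lambda^k_T$. -/

import Mathlib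

/-- `ℝⁿ` with the Euclidean norm. -/
abbrev Vec (n : ℕ) : Type := EuclideanSpace ℝ (Fin n)

/-- The data of a path-constrained dynamic optimization problem with finite-dimensional control:
minimize `Φ (x tf)` over `u ∈ U` subject to `x' t = f (x t) u`, `x t₀ = x₀` and
`h (x t) u ≤ 0` (componentwise) for all `t ∈ [t₀, tf]`. -/
structure DynProblem (nx nu nh : ℕ) where
  t₀ : ℝ
  tf : ℝ
  x₀ : Vec nx
  f : Vec nx → Vec nu → Vec nx
  h : Vec nx → Vec nu → Vec nh
  Φ : Vec nx → ℝ
  U : Set (Vec nu)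

/-- The parameters of the method: Taylor order `q`, Bernstein degree `r`, smoothing parameter `ρ`,
for each constraint component an interval `[ΛL i, ΛU i]` (meant to enclose the `q`-th time
derivative), and the two tolerances. -/
structure TBParams (nh : ℕ) where
  q : ℕ
  r : ℕ
  ρ : ℝ
  ΛL : Fin nh → ℝ
  ΛU : Fin nh → ℝ
  εstat : ℝ
  εact : ℝ

/-- A cell `(i, a, b)`: the time interval `[a, b]`, attached to the `i`-th component of the path
constraint.  (For a scalar path constraint a cell is just a time interval.) -/
abbrev Cell (nh : ℕ) : Type := Fin nh × ℝ × ℝ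

namespace Cell

variable {nh : ℕ}

/-- The constraint component of a cell. -/
def comp (c : Cell nh) : Fin nh := c.1

/-- Left end point. -/
def lo (c : Cell nh) : ℝ := c.2.1

/-- Right end point. -/
def hi (c : Cell nh) : ℝ := c.2.2

/-- The length `Δ(T)`. -/
def width (c : Cell nh) : ℝ := c.hi - c.lo

/-- The midpoint `c(T)`. -/
noncomputable def mid (c : Cell nh) : ℝ := (c.lo + c.hi) / 2

/-- The `N` cells obtained by dividing the interval of `c` into `N` equal parts. -/
noncomputable def split (N : ℕ) (c : Cell nh) : Finset (Cell nh) :=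
  (Finset.range N).image fun k : ℕ =>
    (c.comp, c.lo + k * (c.width / N), c.lo + (k + 1) * (c.width / N))

end Cell

namespace DynProblem

variable {nx nu nh : ℕ}

/-- The time horizon `I = [t₀, tf]`. -/
def horizon (P : DynProblem nx nu nh) : Set ℝ := Set.Icc P.t₀ P.tf

/-- `x` solves the initial value problem on `I` for the control parameter `u`. -/
def IsTrajectory (P : DynProblem nx nu nh) (u : Vec nu) (x : ℝ → Vec nx) : Prop :=
  x P.t₀ = P.x₀ ∧ ∀ t ∈ P.horizon, HasDerivWithinAt x (P.f (x t) u) P.horizon t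

/-- The state trajectory `x(·, u)`: a solution of the initial value problem (an arbitrary function
if there is none; for continuously differentiable `f` the solution is unique on `I`). -/
noncomputable def traj (P : DynProblem nx nu nh) (u : Vec nu) : ℝ → Vec nx :=
  Classical.epsilon fun x => P.IsTrajectory u x

/-- The cost as a function of the control, `u ↦ Φ(x(tf, u))`. -/
noncomputable def cost (P : DynProblem nx nu nh) (u : Vec nu) : ℝ := P.Φ (P.traj u P.tf)

/-- The `i`-th path constraint along the trajectory, `h_i(u, t) = h_i(x(t, u), u)`. -/
noncomputable def path (P : DynProblem nx nu nh) (i : Fin nh) (u : Vec nu) (t : ℝ) : ℝ :=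
  P.h (P.traj u t) u i

/-- The time derivative `∂ʲ h_i(u, t) / ∂tʲ` on `I` (one-sided at the end points of `I`). -/
noncomputable def pathDeriv (P : DynProblem nx nu nh) (i : Fin nh) (j : ℕ) (u : Vec nu) (t : ℝ) :
    ℝ :=
  iteratedDerivWithin j (P.path i u) P.horizon t

/-- Linear growth of the right-hand side: `‖f(x, u)‖ ≤ K (1 + ‖x‖)` for some `K > 0`. -/
def LinearGrowth (P : DynProblem nx nu nh) : Prop :=
  ∃ K : ℝ, 0 < K ∧ ∀ x, ∀ u ∈ P.U, ‖P.f x u‖ ≤ K * (1 + ‖x‖)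

/-- `γ > 0` is a Slater margin: some control in `U` satisfies `h ≤ -γ` on all of `I`. -/
def SlaterMargin (P : DynProblem nx nu nh) (γ : ℝ) : Prop :=
  0 < γ ∧ ∃ us ∈ P.U, ∀ i, ∀ t ∈ P.horizon, P.path i us t ≤ -γ

/-- A finite set of cells that, for every constraint component, subdivides `I` into finitely many
nondegenerate closed intervals without common interior points. -/
def IsSubdivision (P : DynProblem nx nu nh) (C : Finset (Cell nh)) : Prop :=
  (∀ c ∈ C, c.lo < c.hi) ∧
  (∀ i, (⋃ c ∈ {c ∈ C | c.comp = i}, Set.Icc c.lo c.hi) = P.horizon) ∧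
  (∀ c ∈ C, ∀ d ∈ C, c.comp = d.comp → c ≠ d → Disjoint (Set.Ioo c.lo c.hi) (Set.Ioo d.lo d.hi))

section UpperBound

variable (P : DynProblem nx nu nh) (A : TBParams nh)

/-- `[ΛL i, ΛU i]` encloses the `q`-th time derivative of `h_i` on `U × I`. -/
def Encloses : Prop :=
  ∀ i, ∀ u ∈ P.U, ∀ t ∈ P.horizon, P.pathDeriv i A.q u t ∈ Set.Icc (A.ΛL i) (A.ΛU i)

/-- The Taylor polynomial of degree `q - 1` of `h_i(u, ·)` at the midpoint, in the normalized
variable `τ ∈ [0, 1]`: `p*(τ) = ∑_{i < q} aᵢ (Δ (τ - 1/2))ⁱ`. -/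
noncomputable def taylorPoly (u : Vec nu) (c : Cell nh) : Polynomial ℝ :=
  ∑ j ∈ Finset.range A.q,
    Polynomial.C (P.pathDeriv c.comp j u c.mid / (j.factorial : ℝ)) *
      (Polynomial.C c.width * (Polynomial.X - Polynomial.C (1 / 2))) ^ j

/-- The Bernstein coefficient `b_j(u, T) = ∑_{l ≤ min(j, q-1)} α_l C(j, l) / C(r, l)`, where `α_l`
are the coefficients of `p*`. -/
noncomputable def bern (u : Vec nu) (c : Cell nh) (j : ℕ) : ℝ :=
  ∑ l ∈ Finset.range (min j (A.q - 1) + 1),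
    (P.taylorPoly A u c).coeff l * ((j.choose l : ℝ) / (A.r.choose l : ℝ))

end UpperBound

end DynProblem

namespace TBParams

variable {nh : ℕ}

/-- The smoothing bias `δ = ln (r + 1) / ρ`. -/
noncomputable def δ (A : TBParams nh) : ℝ := Real.log ((A.r : ℝ) + 1) / A.ρ

/-- The remainder constant `B_U` of the `i`-th constraint component. -/
noncomputable def BU (A : TBParams nh) (i : Fin nh) : ℝ :=
  if Odd A.q then max |A.ΛL i| |A.ΛU i| else max 0 (A.ΛU i)

/-- The upper bound `(1 / q!) (Δ(T) / 2)^q B_U` of the Taylor remainder on a cell. -/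
noncomputable def remBound (A : TBParams nh) (c : Cell nh) : ℝ :=
  1 / (A.q.factorial : ℝ) * (c.width / 2) ^ A.q * A.BU c.comp

/-- The number of parts into which an active cell is divided,
`max {2, ⌈Δ(T) / (2^q q! (ε_act - δ) / B_U)^(1/q)⌉}`.  For `B_U = 0` the root is infinite in the
formula and the number of parts is `2`; the conventions for division by `0` give the same value. -/
noncomputable def numParts (A : TBParams nh) (c : Cell nh) : ℕ :=
  max 2 ⌈c.width /
    ((2 : ℝ) ^ A.q * (A.q.factorial : ℝ) * (A.εact - A.δ) / A.BU c.comp) ^ (1 / (A.q : ℝ))⌉₊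

end TBParams

namespace DynProblem

variable {nx nu nh : ℕ} (P : DynProblem nx nu nh) (A : TBParams nh)

/-- The smooth Taylor-Bernstein upper bound function
`H_TB(u, T) = (1 / ρ) ln (∑_{j ≤ r} exp (ρ b_j(u, T))) + (1 / q!) (Δ(T) / 2)^q B_U`. -/
noncomputable def HTB (u : Vec nu) (c : Cell nh) : ℝ :=
  1 / A.ρ * Real.log (∑ j ∈ Finset.range (A.r + 1), Real.exp (A.ρ * P.bern A u c j)) + A.remBound c

/-- The feasible set of the approximation problem belonging to a finite set of cells:
`u ∈ U` and `H_TB(u, T) ≤ 0` for all cells. -/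
def approxFeasible (C : Finset (Cell nh)) : Set (Vec nu) :=
  {u | u ∈ P.U ∧ ∀ c ∈ C, P.HTB A u c ≤ 0}

end DynProblem

/-- The data of one iteration of the algorithm: the current cells `Π`, the point `u` returned by
the NLP solver, the cells `Π_grad` selected with it, and their multipliers.  (The last three are
meaningful only if the approximation problem is feasible.) -/
structure Iteration (nu nh : ℕ) where
  cells : Finset (Cell nh)
  u : Vec nu
  grad : Finset (Cell nh)
  mult : Cell nh → ℝ

namespace DynProblem

variable {nx nu nh : ℕ} (P : DynProblem nx nu nh) (A : TBParams nh)

/-- The approximation problem of this iteration is feasible. -/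
def Feasible (s : Iteration nu nh) : Prop := (P.approxFeasible A s.cells).Nonempty

/-- The active cells `Π_act`: the selected cells with `H_TB(u, T) = 0`. -/
noncomputable def active (s : Iteration nu nh) : Finset (Cell nh) :=
  s.grad.filter fun c => P.HTB A s.u c = 0

/-- What the NLP solver delivers for a feasible approximation problem: a locally optimal `u`, at
most `nu` of the cells, and multipliers for them, such that the KKT conditions of the approximation
problem hold (stationarity and complementary slackness; nonnegativity and boundedness of the
multipliers are assumed separately).  The case of exactly `nu` cells with linearly independent
gradients `∇_u H_TB(u, T)` is included; linear independence is not required, so that more runs are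
covered. -/
def SolverOutput (s : Iteration nu nh) : Prop :=
  s.u ∈ P.approxFeasible A s.cells ∧
  IsLocalMinOn P.cost (P.approxFeasible A s.cells) s.u ∧
  s.grad ⊆ s.cells ∧ s.grad.card ≤ nu ∧
  gradient P.cost s.u + ∑ c ∈ s.grad, s.mult c • gradient (fun v => P.HTB A v c) s.u = 0 ∧
  ∀ c ∈ s.grad, s.mult c * P.HTB A s.u c = 0

/-- Approximate stationarity for the original problem. -/
def ApproxStationary (s : Iteration nu nh) : Prop :=
  ‖gradient P.cost s.u + ∑ c ∈ s.grad, s.mult c • gradient (fun v => P.path c.comp v c.mid) s.u‖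
    ≤ A.εstat

/-- Approximate complementarity for the original problem. -/
def ApproxComplementary (s : Iteration nu nh) : Prop :=
  ∀ c ∈ s.grad, s.mult c * P.path c.comp s.u c.mid ∈ Set.Icc (-(s.mult c * A.εact)) 0

/-- Feasibility for the original path constraint on all of `I`. -/
def PathFeasible (u : Vec nu) : Prop := ∀ i, ∀ t ∈ P.horizon, P.path i u t ≤ 0

/-- The algorithm terminates in this iteration: the approximation problem is feasible and the
solver output passes the three tests. -/
def Terminates (s : Iteration nu nh) : Prop :=
  P.Feasible A s ∧ P.ApproxStationary A s ∧ P.ApproxComplementary A s ∧ P.PathFeasible s.u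

open Classical in
/-- The cells of the next iteration.  Feasible (Case 1): every active cell is divided into
`numParts` equal parts, the other cells are kept.  Infeasible (Case 2): every cell is bisected. -/
noncomputable def nextCells (s : Iteration nu nh) : Finset (Cell nh) :=
  if P.Feasible A s then
    (P.active A s).biUnion (fun c => c.split (A.numParts c)) ∪ (s.cells \ P.active A s)
  else s.cells.biUnion fun c => c.split 2

/-- Iteration `k` is reached: the algorithm has not terminated in an earlier iteration. -/
def Reached (s : ℕ → Iteration nu nh) (k : ℕ) : Prop := ∀ j < k, ¬ P.Terminates A (s j)

/-- `s` records a run of the algorithm: it starts from a subdivision of `I`, and in every iteration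
that is reached the solver, if the approximation problem is feasible, delivers its output and,
unless the algorithm terminates in it, the cells are updated.  Nothing is required of `s k` after
termination.  The solver may choose its output in any way (in particular depending on an initial
guess such as the previous point). -/
def IsRun (s : ℕ → Iteration nu nh) : Prop :=
  P.IsSubdivision (s 0).cells ∧
  ∀ k, P.Reached A s k →
    (P.Feasible A (s k) → P.SolverOutput A (s k)) ∧
    (¬ P.Terminates A (s k) → (s (k + 1)).cells = P.nextCells A (s k))

/-- The KKT multipliers are nonnegative and uniformly bounded throughout all iterations. -/
def BoundedMultipliers (s : ℕ → Iteration nu nh) : Prop :=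
  ∃ M : ℝ, ∀ k, P.Reached A s k → P.Feasible A (s k) →
    ∀ c ∈ (s k).grad, 0 ≤ (s k).mult c ∧ (s k).mult c ≤ M

end DynProblem

/-! The core is one uniform estimate (`exists_HTB_sub_path_le`): on a cell of width `Δ ≤ 1`, `H_TB`
exceeds the midpoint value of the path constraint by at most `δ + C Δ`, and the gradients of the two
differ by at most `C Δ`, with one `C` for all `u ∈ U`. Conversely `H_TB` bounds the constraint from
above on the whole cell (`path_le_HTB`: Taylor remainder, Bernstein bound, smooth maximum).

Fix a small width `η`. If no cell is wider than `η`, the Slater control satisfies `H_TB ≤ -γ + δ + C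
η ≤ 0`, so an infeasible iteration has a wider cell. In a feasible iteration test (3) holds by the
upper bound. If all active cells have width at most `η`, complementary slackness leaves nonzero
multipliers only on narrow cells with `H_TB = 0`, and the estimate turns the KKT conditions into (1)
and (2). So every iteration that does not terminate divides a cell wider than `η` into at least two
equal parts, and a potential that drops by at least `1` each time shows that this happens finitely
often.

The constant `C` comes from the dynamics. Linear growth keeps the trajectories in a compact set, and
they depend differentiably on the control. Time derivatives of the constraint are iterated Lie
derivatives evaluated at `(x(t, u), u)`; those of order below `q` are `C¹`, so their values and
`u`-gradients are bounded on `U × I`. Every Bernstein coefficient is the midpoint value plus `O(Δ)`,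
and the gradient of the smooth maximum is a weighted mean of their gradients, so the bias `δ`
affects values only. -/

/-! ### Existence, uniqueness and parameter dependence for ordinary differential equations -/

section OrdinaryDifferentialEquations

open Set Metric Filter Topology
open scoped NNReal

variable {E V : Type*} [NormedAddCommGroup E] [NormedSpace ℝ E]
  [NormedAddCommGroup V] [NormedSpace ℝ V]

/-- Grönwall's inequality for a function that is differentiable within a compact interval. -/
theorem norm_le_gronwallBound_of_hasDerivWithinAt_Icc {x x' : ℝ → E} {a b δ K ε : ℝ}
    (hx : ∀ t ∈ Icc a b, HasDerivWithinAt x (x' t) (Icc a b) t) (ha : ‖x a‖ ≤ δ)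
    (bound : ∀ t ∈ Icc a b, ‖x' t‖ ≤ K * ‖x t‖ + ε) :
    ∀ t ∈ Icc a b, ‖x t‖ ≤ gronwallBound δ K ε (t - a) :=
  norm_le_gronwallBound_of_norm_deriv_right_le
    (fun t ht => (hx t ht).continuousWithinAt)
    (fun t ht => (hx t (Ico_subset_Icc_self ht)).mono_of_mem_nhdsWithin
      (Icc_mem_nhdsGE_of_mem ht)) ha
    (fun t ht => bound t (Ico_subset_Icc_self ht))

/-- Pulls the size of the parameter increment out of Grönwall's inequality, giving Lipschitz and
little-o estimates. -/
theorem gronwallBound_zero_mul (K ε c x : ℝ) :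
    gronwallBound 0 K (c * ε) x = c * gronwallBound 0 K ε x := by
  by_cases hK : K = 0
  · subst hK; simp only [gronwallBound_K0]; ring
  · simp only [gronwallBound_of_K_ne_0 hK]; ring

theorem gronwallBound_nonneg {δ K ε x : ℝ} (hδ : 0 ≤ δ) (hε : 0 ≤ ε) (hK : 0 ≤ K) (hx : 0 ≤ x) :
    0 ≤ gronwallBound δ K ε x := by
  have h := gronwallBound_mono hδ hε hK hx
  rw [gronwallBound_x0] at h
  exact hδ.trans h

theorem IsIntegralCurveOn.eqOn_Icc_of_lipschitzOnWith {F : ℝ → E → E} {x y : ℝ → E} {a b : ℝ}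
    {K : ℝ≥0} {s : Set E} (hF : ∀ t ∈ Icc a b, LipschitzOnWith K (F t) s)
    (hx : IsIntegralCurveOn x F (Icc a b)) (hxs : ∀ t ∈ Icc a b, x t ∈ s)
    (hy : IsIntegralCurveOn y F (Icc a b)) (hys : ∀ t ∈ Icc a b, y t ∈ s) (h : x a = y a) :
    EqOn x y (Icc a b) :=
  ODE_solution_unique_of_mem_Icc_right (s := fun _ => s) (K := K) (v := F)
    (fun t ht => hF t (Ico_subset_Icc_self ht)) hx.continuousOn
    (fun t ht => (hx t (Ico_subset_Icc_self ht)).mono_of_mem_nhdsWithin (Icc_mem_nhdsGE_of_mem ht))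
    (fun t ht => hxs t (Ico_subset_Icc_self ht)) hy.continuousOn
    (fun t ht => (hy t (Ico_subset_Icc_self ht)).mono_of_mem_nhdsWithin (Icc_mem_nhdsGE_of_mem ht))
    (fun t ht => hys t (Ico_subset_Icc_self ht)) h

theorem exists_isIntegralCurveOn_Icc_of_mul_le [CompleteSpace E] {F : ℝ → E → E} {c d : ℝ} {K : ℝ≥0}
    (hcd : c ≤ d) (hLip : ∀ t ∈ Icc c d, LipschitzWith K (F t))
    (hcont : ∀ x, ContinuousOn (fun t => F t x) (Icc c d)) (hK : K * (d - c) ≤ 1 / 2) (x₀ : E) :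
    ∃ x : ℝ → E, x c = x₀ ∧ IsIntegralCurveOn x F (Icc c d) := by
  obtain ⟨M, hM⟩ := isCompact_Icc.exists_bound_of_continuousOn (hcont x₀)
  have hM0 : 0 ≤ M := (norm_nonneg _).trans (hM c (left_mem_Icc.2 hcd))
  -- With radius `A = 2 M (d - c)` the speed on the ball is at most `M + K A`, and `(M + K A) (d -
  -- c) ≤ A` because `K (d - c) ≤ 1 / 2`.
  set A : ℝ≥0 := ⟨2 * M * (d - c), by have := sub_nonneg.2 hcd; positivity⟩ with hA
  have hpl : IsPicardLindelof F (⟨c, left_mem_Icc.2 hcd⟩ : Icc c d) x₀ A 0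
      (⟨M, hM0⟩ + K * A) K :=
    { lipschitzOnWith := fun t ht => (hLip t ht).lipschitzOnWith
      continuousOn := fun x _ => hcont x
      norm_le := fun t ht x hx => by
        have h1 := (hLip t ht).norm_sub_le x x₀
        have h2 : ‖x - x₀‖ ≤ A := by simpa [dist_eq_norm] using hx
        have h3 : ‖F t x‖ ≤ ‖F t x₀‖ + ‖F t x - F t x₀‖ := by
          simpa using norm_add_le (F t x₀) (F t x - F t x₀)
        have h4 : (K : ℝ) * ‖x - x₀‖ ≤ K * A := by gcongr
        have h5 := hM t ht
        change _ ≤ M + (K : ℝ) * A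
        linarith
      mul_max_le := by
        have h1 : 0 ≤ d - c := sub_nonneg.2 hcd
        rw [max_eq_left (by simpa using h1)]
        push_cast
        change (M + K * (2 * M * (d - c))) * (d - c) ≤ 2 * M * (d - c) - 0
        have h2 : (K * (d - c)) * (2 * M * (d - c)) ≤ 1 / 2 * (2 * M * (d - c)) := by gcongr
        nlinarith }
  exact hpl.exists_eq_forall_mem_Icc_hasDerivWithinAt₀

/-- At the junction both one-sided derivatives equal `F` at the common value; elsewhere the other
subinterval is irrelevant, `t` being outside its closure. -/
theorem IsIntegralCurveOn.exists_extend {F : ℝ → E → E} {a c d : ℝ} {x y : ℝ → E}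
    (hac : a ≤ c) (hcd : c ≤ d) (hx : IsIntegralCurveOn x F (Icc a c))
    (hy : IsIntegralCurveOn y F (Icc c d)) (h : y c = x c) :
    ∃ z : ℝ → E, z a = x a ∧ IsIntegralCurveOn z F (Icc a d) := by
  set z : ℝ → E := fun t => if t ≤ c then x t else y t with hz
  have hzx : ∀ t ≤ c, z t = x t := fun t ht => if_pos ht
  have hzy : ∀ t, c ≤ t → z t = y t := fun t ht => by
    rcases ht.eq_or_lt with rfl | ht
    · rw [hzx _ le_rfl, h]
    · exact if_neg ht.not_ge
  have hz1 : ∀ t ∈ Icc a c, HasDerivWithinAt z (F t (z t)) (Icc a c) t := fun t ht => by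
    rw [hzx t ht.2]
    exact (hx t ht).congr (fun s hs => hzx s hs.2) (hzx t ht.2)
  have hz2 : ∀ t ∈ Icc c d, HasDerivWithinAt z (F t (z t)) (Icc c d) t := fun t ht => by
    rw [hzy t ht.1]
    exact (hy t ht).congr (fun s hs => hzy s hs.1) (hzy t ht.1)
  refine ⟨z, hzx a hac, fun t ht => ?_⟩
  rw [← Icc_union_Icc_eq_Icc hac hcd]
  rcases lt_trichotomy t c with htc | rfl | htc
  · refine (hz1 t ⟨ht.1, htc.le⟩).union ?_
    exact hasDerivWithinAt_iff_hasFDerivWithinAt.2 (.of_notMem_closure (by simp [isClosed_Icc.closure_eq, htc]))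
  · exact (hz1 t ⟨ht.1, le_rfl⟩).union (hz2 t ⟨le_rfl, ht.2⟩)
  · refine HasDerivWithinAt.union ?_ (hz2 t ⟨htc.le, ht.2⟩)
    exact hasDerivWithinAt_iff_hasFDerivWithinAt.2 (.of_notMem_closure (by simp [isClosed_Icc.closure_eq, htc]))

/-- A globally Lipschitz ordinary differential equation has a solution on the whole interval. -/
theorem exists_isIntegralCurveOn_Icc_of_lipschitzWith [CompleteSpace E] {F : ℝ → E → E} {a b : ℝ}
    {K : ℝ≥0} (hab : a ≤ b) (hLip : ∀ t ∈ Icc a b, LipschitzWith K (F t))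
    (hcont : ∀ x, ContinuousOn (fun t => F t x) (Icc a b)) (x₀ : E) :
    ∃ x : ℝ → E, x a = x₀ ∧ IsIntegralCurveOn x F (Icc a b) := by
  have key : ∀ n : ℕ, ∀ d ∈ Icc a b, K * (d - a) ≤ (n + 1) / 2 →
      ∃ x : ℝ → E, x a = x₀ ∧ IsIntegralCurveOn x F (Icc a d) := by
    intro n
    induction n with
    | zero =>
      intro d hd hK
      have hsub : Icc a d ⊆ Icc a b := Icc_subset_Icc_right hd.2
      exact exists_isIntegralCurveOn_Icc_of_mul_le hd.1 (fun t ht => hLip t (hsub ht))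
        (fun x => (hcont x).mono hsub) (by simpa using hK) x₀
    | succ n ih =>
      intro d hd hK
      push_cast at hK
      have hn : (0 : ℝ) < n + 2 := by positivity
      have hda : 0 ≤ d - a := sub_nonneg.2 hd.1
      -- One of `n + 2` equal pieces is short enough for the local result; the other `n + 1` are
      -- covered by induction.
      set e : ℝ := (d - a) / (n + 2) with he
      have he0 : 0 ≤ e := by positivity
      have hde : d - a = (n + 2) * e := by rw [he]; field_simp
      have hac : a ≤ d - e := by nlinarith [(Nat.cast_nonneg n : (0 : ℝ) ≤ n)]
      have hKe : K * e ≤ 1 / 2 := by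
        rw [hde] at hK
        by_contra! hcon
        nlinarith
      obtain ⟨x, hxa, hx⟩ := ih (d - e) ⟨hac, by linarith [hd.2]⟩ (by
        have : d - e - a = (n + 1) * e := by linarith
        rw [this]
        nlinarith [(Nat.cast_nonneg n : (0 : ℝ) ≤ n)])
      have hsub : Icc (d - e) d ⊆ Icc a b := Icc_subset_Icc hac hd.2
      obtain ⟨y, hyc, hy⟩ := exists_isIntegralCurveOn_Icc_of_mul_le (c := d - e) (d := d) (K := K)
        (F := F) (by linarith) (fun t ht => hLip t (hsub ht)) (fun x => (hcont x).mono hsub)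
        (by simpa using hKe) (x (d - e))
      obtain ⟨z, hza, hz⟩ := hx.exists_extend hac (by linarith) hy hyc
      exact ⟨z, hza.trans hxa, hz⟩
  obtain ⟨n, hn⟩ := exists_nat_ge (2 * (K * (b - a)))
  exact key n b (right_mem_Icc.2 hab) (by linarith)

omit [NormedSpace ℝ V] in
/-- Lipschitz dependence of the solution of `x' = F (x, u)` on the parameter `u`. -/
theorem norm_sub_le_mul_of_isIntegralCurveOn {F : E × V → E} {X : V → ℝ → E} {x₀ : E} {a b : ℝ}
    {K : ℝ≥0} (hF : LipschitzWith K F) (hXa : ∀ u, X u a = x₀)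
    (hX : ∀ u, IsIntegralCurveOn (X u) (fun _ x => F (x, u)) (Icc a b)) (u v : V) {t : ℝ}
    (ht : t ∈ Icc a b) :
    ‖X u t - X v t‖ ≤ gronwallBound 0 K K (b - a) * ‖u - v‖ := by
  have h := norm_le_gronwallBound_of_hasDerivWithinAt_Icc (x := fun t => X u t - X v t)
    (δ := 0) (K := K) (ε := ‖u - v‖ * K)
    (fun t ht => (hX u t ht).sub (hX v t ht)) (by simp [hXa]) (fun t _ => by
      have h1 := hF.norm_sub_le (X u t, u) (X v t, v)
      rw [Prod.mk_sub_mk, Prod.norm_mk] at h1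
      have h2 : max ‖X u t - X v t‖ ‖u - v‖ ≤ ‖X u t - X v t‖ + ‖u - v‖ :=
        max_le_add_of_nonneg (norm_nonneg _) (norm_nonneg _)
      nlinarith [K.coe_nonneg]) t ht
  rw [gronwallBound_zero_mul, mul_comm] at h
  refine h.trans ?_
  gcongr
  exact gronwallBound_mono le_rfl K.coe_nonneg K.coe_nonneg (by linarith [ht.2])

/-- If the derivative is uniformly continuous, first-order expansion holds with a uniform error. -/
theorem exists_forall_norm_sub_sub_fderiv_le {F : E → V} (hF : Differentiable ℝ F)
    (hF' : UniformContinuous (fderiv ℝ F)) {ε : ℝ} (hε : 0 < ε) :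
    ∃ δ > 0, ∀ p q, ‖q - p‖ < δ → ‖F q - F p - fderiv ℝ F p (q - p)‖ ≤ ε * ‖q - p‖ := by
  obtain ⟨δ, hδ, h⟩ := Metric.uniformContinuous_iff.1 hF' ε hε
  refine ⟨δ, hδ, fun p q hpq => ?_⟩
  refine (convex_ball p δ).norm_image_sub_le_of_norm_hasFDerivWithin_le' (f' := fderiv ℝ F)
    (fun z _ => (hF z).hasFDerivAt.hasFDerivWithinAt) (fun z hz => ?_) (mem_ball_self hδ)
    (by simpa [dist_eq_norm] using hpq)
  rw [← dist_eq_norm]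
  exact (h hz).le

/-- Differentiable dependence of the solution of `x' = F (x, u)` on the parameter `u`. -/
theorem differentiable_of_isIntegralCurveOn [CompleteSpace E] {F : E × V → E} {X : V → ℝ → E}
    {x₀ : E} {a b : ℝ} {K : ℝ≥0} (hF : LipschitzWith K F) (hF1 : ContDiff ℝ 1 F)
    (hF' : UniformContinuous (fderiv ℝ F)) (hXa : ∀ u, X u a = x₀)
    (hX : ∀ u, IsIntegralCurveOn (X u) (fun _ x => F (x, u)) (Icc a b)) {t : ℝ}
    (ht : t ∈ Icc a b) : Differentiable ℝ fun u => X u t := by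
  intro u₀
  have hab : a ≤ b := ht.1.trans ht.2
  have hFd : Differentiable ℝ F := hF1.differentiable one_ne_zero
  set D : ℝ → E × V →L[ℝ] E := fun t => fderiv ℝ F (X u₀ t, u₀) with hD
  have hDc : ContinuousOn D (Icc a b) :=
    (hF1.continuous_fderiv one_ne_zero).comp_continuousOn
      ((hX u₀).continuousOn.prodMk continuousOn_const)
  have hDn : ∀ t, ‖D t‖ ≤ K := fun t => norm_fderiv_le_of_lipschitz ℝ hF
  -- Right-hand side of the variational equation along `X u₀`; its solution `Y` with `Y a = 0` is
  -- the candidate derivative.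
  set G : ℝ → (V →L[ℝ] E) → (V →L[ℝ] E) :=
    fun t Y => (D t).comp (Y.prod (ContinuousLinearMap.id ℝ V)) with hG
  obtain ⟨Y, hYa, hY⟩ := exists_isIntegralCurveOn_Icc_of_lipschitzWith (F := G) (K := K) hab
    (fun t _ => LipschitzWith.of_dist_le_mul fun Y Z => by
      rw [dist_eq_norm, dist_eq_norm]
      refine ContinuousLinearMap.opNorm_le_bound _ (by positivity) fun v => ?_
      have : (G t Y - G t Z) v = D t ((Y - Z) v, 0) := by
        simp [hG, ← map_sub]
      rw [this]
      refine ((D t).le_opNorm _).trans ?_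
      rw [Prod.norm_mk, norm_zero, max_eq_left (norm_nonneg _), mul_assoc]
      exact mul_le_mul (hDn t) ((Y - Z).le_opNorm v) (norm_nonneg _) K.coe_nonneg)
    (fun Y => hDc.clm_comp continuousOn_const) 0
  refine HasFDerivAt.differentiableAt (f' := Y t) ?_
  rw [hasFDerivAt_iff_isLittleO_nhds_zero, Asymptotics.isLittleO_iff]
  intro ε hε
  set C : ℝ := gronwallBound 0 K K (b - a) with hC
  have hC0 : 0 ≤ C := gronwallBound_nonneg le_rfl K.coe_nonneg K.coe_nonneg (sub_nonneg.2 hab)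
  set C' : ℝ := gronwallBound 0 K 1 (b - a) with hC'
  have hC'0 : 0 ≤ C' := gronwallBound_nonneg le_rfl zero_le_one K.coe_nonneg (sub_nonneg.2 hab)
  -- The tolerance anticipates two losses: `C + 1` from the joint increment of state and parameter,
  -- `C'` from Grönwall.
  obtain ⟨δ, hδ, hexp⟩ := exists_forall_norm_sub_sub_fderiv_le hFd hF'
    (ε := ε / ((C + 1) * (C' + 1))) (by positivity)
  filter_upwards [Metric.ball_mem_nhds (0 : V) (show 0 < δ / (C + 1) by positivity)] with v hv
  rw [mem_ball_zero_iff, lt_div_iff₀ (by positivity)] at hv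
  have hdiff : ∀ t ∈ Icc a b, ‖X (u₀ + v) t - X u₀ t‖ ≤ C * ‖v‖ := fun t ht => by
    simpa using norm_sub_le_mul_of_isIntegralCurveOn hF hXa hX (u₀ + v) u₀ ht
  have hpair : ∀ t ∈ Icc a b, ‖((X (u₀ + v) t, u₀ + v) - (X u₀ t, u₀) : E × V)‖ ≤
      (C + 1) * ‖v‖ := fun t ht => by
    rw [Prod.mk_sub_mk, Prod.norm_mk, add_sub_cancel_left]
    have := hdiff t ht
    have h0 := norm_nonneg v
    exact max_le (by nlinarith) (by nlinarith)
  have h := norm_le_gronwallBound_of_hasDerivWithinAt_Icc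
    (x := fun t => X (u₀ + v) t - X u₀ t - Y t v)
    (δ := 0) (K := K) (ε := (ε / (C' + 1) * ‖v‖) * 1)
    (fun t ht => ((hX (u₀ + v) t ht).sub (hX u₀ t ht)).sub ((hY t ht).clm_apply
      (hasDerivWithinAt_const t _ v))) (by simp [hXa, hYa]) (fun t ht => by
      have h1 := hexp (X u₀ t, u₀) (X (u₀ + v) t, u₀ + v) (by
        have := hpair t ht
        linarith)
      have h2 : F (X (u₀ + v) t, u₀ + v) - F (X u₀ t, u₀) - (G t (Y t) v + Y t 0) =
          (F (X (u₀ + v) t, u₀ + v) - F (X u₀ t, u₀) -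
            D t ((X (u₀ + v) t, u₀ + v) - (X u₀ t, u₀))) +
          D t (X (u₀ + v) t - X u₀ t - Y t v, 0) := by
        have : ((X (u₀ + v) t, u₀ + v) - (X u₀ t, u₀) : E × V) =
            (X (u₀ + v) t - X u₀ t - Y t v, 0) + (Y t v, v) := by
          simp
        rw [this, map_add]
        simp only [hG, ContinuousLinearMap.comp_apply, ContinuousLinearMap.prod_apply,
          ContinuousLinearMap.id_apply, map_zero]
        abel
      rw [h2]
      have h3 : ‖D t (X (u₀ + v) t - X u₀ t - Y t v, 0)‖ ≤ K * ‖X (u₀ + v) t - X u₀ t - Y t v‖ := by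
        refine ((D t).le_opNorm _).trans ?_
        rw [Prod.norm_mk, norm_zero, max_eq_left (norm_nonneg _)]
        gcongr
        exact hDn t
      have h4 : ε / ((C + 1) * (C' + 1)) * ‖((X (u₀ + v) t, u₀ + v) - (X u₀ t, u₀) : E × V)‖ ≤
          ε / (C' + 1) * ‖v‖ := by
        calc _ ≤ ε / ((C + 1) * (C' + 1)) * ((C + 1) * ‖v‖) := by gcongr; exact hpair t ht
          _ = _ := by field_simp
      refine (norm_add_le _ _).trans ?_
      linarith) t ht
  rw [gronwallBound_zero_mul] at h
  refine h.trans ?_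
  have h5 : gronwallBound 0 K 1 (t - a) ≤ C' :=
    gronwallBound_mono le_rfl zero_le_one K.coe_nonneg (by linarith [ht.2])
  calc _ ≤ ε / (C' + 1) * ‖v‖ * (C' + 1) := by gcongr; linarith
    _ = ε * ‖v‖ := by field_simp

end OrdinaryDifferentialEquations

/-! ### Cutting off the vector field -/

section Cutoff

open Set Metric

/-- A `C¹` function can be cut off outside a prescribed ball without increasing its norm. -/
theorem ContDiff.exists_cutoff {E V W : Type*} [NormedAddCommGroup E] [InnerProductSpace ℝ E]
    [FiniteDimensional ℝ E] [NormedAddCommGroup V] [InnerProductSpace ℝ V]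
    [FiniteDimensional ℝ V] [NormedAddCommGroup W] [NormedSpace ℝ W] {f : E × V → W}
    (hf : ContDiff ℝ 1 f) {R : ℝ} (hR : 0 < R) :
    ∃ g : E × V → W, ContDiff ℝ 1 g ∧ HasCompactSupport g ∧
      (∀ x u, ‖x‖ ≤ R → ‖u‖ ≤ R → g (x, u) = f (x, u)) ∧ ∀ p, ‖g p‖ ≤ ‖f p‖ := by
  let χ : ContDiffBump (0 : E) := ⟨R, R + 1, hR, by linarith⟩
  let ψ : ContDiffBump (0 : V) := ⟨R, R + 1, hR, by linarith⟩
  refine ⟨fun p => (χ p.1 * ψ p.2) • f p,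
    ((χ.contDiff.comp contDiff_fst).mul (ψ.contDiff.comp contDiff_snd)).smul hf, ?_, ?_, ?_⟩
  · refine HasCompactSupport.intro (K := closedBall (0 : E) (R + 1) ×ˢ closedBall (0 : V) (R + 1))
      ((isCompact_closedBall _ _).prod (isCompact_closedBall _ _)) fun p hp => ?_
    rw [mem_prod, not_and_or, mem_closedBall, mem_closedBall, not_le, not_le] at hp
    rcases hp with hp | hp
    · simp [χ.zero_of_le_dist hp.le]
    · simp [ψ.zero_of_le_dist hp.le]
  · intro x u hx hu
    simp [χ.one_of_mem_closedBall (x := x) (by simpa [χ] using hx),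
      ψ.one_of_mem_closedBall (x := u) (by simpa [ψ] using hu)]
  · intro p
    rw [norm_smul, norm_mul, Real.norm_of_nonneg χ.nonneg, Real.norm_of_nonneg ψ.nonneg]
    exact mul_le_of_le_one_left (norm_nonneg _) (mul_le_one₀ χ.le_one ψ.nonneg ψ.le_one)

end Cutoff

/-! ### Trajectories of the control problem -/

namespace DynProblem

open Set Metric Filter Topology
open scoped NNReal

variable {nx nu nh : ℕ} {P : DynProblem nx nu nh}

theorem IsTrajectory.isTrajectory_traj {u : Vec nu} {x : ℝ → Vec nx} (h : P.IsTrajectory u x) :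
    P.IsTrajectory u (P.traj u) :=
  Classical.epsilon_spec (p := fun x => P.IsTrajectory u x) ⟨x, h⟩

theorem IsTrajectory.continuousOn {u : Vec nu} {x : ℝ → Vec nx} (h : P.IsTrajectory u x) :
    ContinuousOn x P.horizon := fun t ht => (h.2 t ht).continuousWithinAt

/-- `f` is only locally Lipschitz, but both trajectories are bounded on the compact interval, so a
common ball suffices. -/
theorem IsTrajectory.eqOn (hf : ContDiff ℝ 1 fun p : Vec nx × Vec nu => P.f p.1 p.2)
    {u : Vec nu} {x y : ℝ → Vec nx} (hx : P.IsTrajectory u x) (hy : P.IsTrajectory u y) :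
    EqOn x y P.horizon := by
  obtain ⟨M, hM⟩ := isCompact_Icc.exists_bound_of_continuousOn hx.continuousOn
  obtain ⟨N, hN⟩ := isCompact_Icc.exists_bound_of_continuousOn hy.continuousOn
  have hfu : ContDiff ℝ 1 fun x => P.f x u := hf.comp (contDiff_id.prodMk contDiff_const)
  obtain ⟨K, hK⟩ := hfu.contDiffOn.exists_lipschitzOnWith one_ne_zero
    (convex_closedBall (0 : Vec nx) (max M N)) (isCompact_closedBall _ _)
  exact IsIntegralCurveOn.eqOn_Icc_of_lipschitzOnWith (F := fun _ x => P.f x u)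
    (fun _ _ => hK) hx.2
    (fun t ht => mem_closedBall_zero_iff.2 ((hM t ht).trans (le_max_left _ _))) hy.2
    (fun t ht => mem_closedBall_zero_iff.2 ((hN t ht).trans (le_max_right _ _)))
    (hx.1.trans hy.1.symm)

/-- Under linear growth the trajectories exist for all controls near `U`, and they are bounded and
depend differentiably on the control, uniformly in `U` and in time. -/
theorem LinearGrowth.exists_bound_traj (hgrowth : P.LinearGrowth) (htime : P.t₀ ≤ P.tf)
    (hU : IsCompact P.U) (hf : ContDiff ℝ 1 fun p : Vec nx × Vec nu => P.f p.1 p.2) :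
    ∃ C, 0 ≤ C ∧ (∀ u ∈ P.U, ∀ᶠ v in 𝓝 u, P.IsTrajectory v (P.traj v)) ∧
      ∀ u ∈ P.U, ∀ t ∈ P.horizon, ‖P.traj u t‖ ≤ C ∧
        DifferentiableAt ℝ (fun v => P.traj v t) u ∧ ‖fderiv ℝ (fun v => P.traj v t) u‖ ≤ C := by
  obtain ⟨K, hK, hgr⟩ := hgrowth
  obtain ⟨ρ, hρ⟩ := hU.isBounded.exists_norm_le
  set R := gronwallBound ‖P.x₀‖ K K (P.tf - P.t₀) with hR
  have hR0 : 0 ≤ R := gronwallBound_nonneg (norm_nonneg _) hK.le hK.le (sub_nonneg.2 htime)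
  -- `R` bounds the states and `ρ` the controls in `U`; the extra `1` leaves room for nearby
  -- controls. The cutoff `g` is globally Lipschitz and inherits linear growth from `f`, and its
  -- solutions near `U` stay where `g = f`.
  obtain ⟨g, hg1, hgc, hgf, hgn⟩ := hf.exists_cutoff (R := R + 1 + |ρ|) (by positivity)
  obtain ⟨L, hL⟩ := hg1.lipschitzWith_of_hasCompactSupport hgc one_ne_zero
  have hg' : UniformContinuous (fderiv ℝ g) :=
    (hgc.fderiv ℝ).uniformContinuous_of_continuous (hg1.continuous_fderiv one_ne_zero)
  have hex : ∀ u : Vec nu, ∃ x : ℝ → Vec nx, x P.t₀ = P.x₀ ∧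
      IsIntegralCurveOn x (fun _ x => g (x, u)) (Icc P.t₀ P.tf) := fun u =>
    exists_isIntegralCurveOn_Icc_of_lipschitzWith (F := fun _ x => g (x, u)) (K := L) htime
      (fun t _ => LipschitzWith.of_dist_le_mul fun x y => by
        simpa [Prod.dist_eq] using hL.dist_le_mul (x, u) (y, u))
      (fun x => continuousOn_const) P.x₀
  choose X hXa hX using hex
  set C := gronwallBound 0 L L (P.tf - P.t₀) with hC
  have hC0 : 0 ≤ C :=
    gronwallBound_nonneg le_rfl L.coe_nonneg L.coe_nonneg (sub_nonneg.2 htime)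
  have hXR : ∀ u ∈ P.U, ∀ t ∈ P.horizon, ‖X u t‖ ≤ R := fun u hu t ht => by
    refine (norm_le_gronwallBound_of_hasDerivWithinAt_Icc (K := K) (ε := K) (δ := ‖P.x₀‖)
      (hX u) (by rw [hXa]) (fun t _ => ?_) t ht).trans
      (gronwallBound_mono (norm_nonneg _) hK.le hK.le (by linarith [ht.2]))
    have h1 := hgr (X u t) u hu
    have h2 := hgn (X u t, u)
    linarith
  have hlip := fun u v t (ht : t ∈ P.horizon) =>
    norm_sub_le_mul_of_isIntegralCurveOn hL hXa hX u v ht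
  have htraj : ∀ u ∈ P.U, ∀ᶠ v in 𝓝 u, P.IsTrajectory v (X v) := fun u hu => by
    filter_upwards [ball_mem_nhds u (show 0 < 1 / (C + 1) by positivity)] with v hv
    rw [mem_ball, dist_eq_norm, lt_div_iff₀ (by positivity)] at hv
    have hv1 : ‖v - u‖ ≤ 1 := by nlinarith [norm_nonneg (v - u)]
    have hvn : ‖v‖ ≤ R + 1 + |ρ| := by
      have h1 : ‖v‖ ≤ ‖u‖ + ‖v - u‖ := by simpa using norm_add_le u (v - u)
      have h2 := hρ u hu
      have h3 := le_abs_self ρ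
      linarith
    refine ⟨hXa v, fun t ht => ?_⟩
    have hXv : ‖X v t‖ ≤ R + 1 + |ρ| := by
      have h1 : ‖X v t‖ ≤ ‖X u t‖ + ‖X v t - X u t‖ := by
        simpa using norm_add_le (X u t) (X v t - X u t)
      have h2 := hlip v u t ht
      have h3 := hXR u hu t ht
      have h4 := abs_nonneg ρ
      nlinarith [norm_nonneg (v - u)]
    have := hX v t ht
    beta_reduce at this
    rwa [hgf _ _ hXv hvn] at this
  have heq : ∀ u ∈ P.U, ∀ᶠ v in 𝓝 u, EqOn (P.traj v) (X v) P.horizon := fun u hu =>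
    (htraj u hu).mono fun v hv => hv.isTrajectory_traj.eqOn hf hv
  refine ⟨max R C, hR0.trans (le_max_left _ _),
    fun u hu => (htraj u hu).mono fun v hv => hv.isTrajectory_traj, fun u hu t ht => ?_⟩
  have hev : (fun v => P.traj v t) =ᶠ[𝓝 u] fun v => X v t := (heq u hu).mono fun v hv => hv ht
  refine ⟨?_, ?_, ?_⟩
  · rw [(heq u hu).self_of_nhds ht]
    exact (hXR u hu t ht).trans (le_max_left _ _)
  · exact (differentiable_of_isIntegralCurveOn hL hg1 hg' hXa hX ht u).congr_of_eventuallyEq hev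
  · rw [hev.fderiv_eq]
    exact (norm_fderiv_le_of_lip' ℝ hC0 (.of_forall fun v => hlip v u t ht)).trans
      (le_max_right _ _)

end DynProblem

/-! ### Time derivatives and Taylor's formula -/

section TimeDerivatives

open Set

/-- Functions each of which is the derivative of its predecessor are the iterated derivatives of
the first one. -/
theorem iteratedDerivWithin_eqOn_of_hasDerivWithinAt {E : Type*} [NormedAddCommGroup E]
    [NormedSpace ℝ E] {g : ℕ → ℝ → E} {s : Set ℝ}
    (hs : UniqueDiffOn ℝ s) {q : ℕ}
    (h : ∀ m < q, ∀ t ∈ s, HasDerivWithinAt (g m) (g (m + 1) t) s t) :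
    ∀ m ≤ q, EqOn (iteratedDerivWithin m (g 0) s) (g m) s := by
  intro m
  induction m with
  | zero => intro _ t _; simp
  | succ m ih =>
    intro hm t ht
    rw [iteratedDerivWithin_succ, derivWithin_congr (ih (by lia)) (ih (by lia) ht)]
    exact (h m (by lia) t ht).derivWithin (hs t ht)

/-- Taylor's formula with Lagrange remainder for a chain of derivatives on an interval. -/
theorem exists_taylor_lagrange_of_hasDerivWithinAt {g : ℕ → ℝ → ℝ} {s : Set ℝ} [hs : OrdConnected s]
    {q : ℕ} (hq : 1 ≤ q) (h : ∀ m < q, ∀ t ∈ s, HasDerivWithinAt (g m) (g (m + 1) t) s t)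
    {c t : ℝ} (hc : c ∈ s) (ht : t ∈ s) :
    ∃ ξ ∈ s, g 0 t = ∑ m ∈ Finset.range q, g m c / m.factorial * (t - c) ^ m +
      g q ξ / q.factorial * (t - c) ^ q := by
  obtain ⟨n, rfl⟩ : ∃ n, q = n + 1 := ⟨q - 1, by lia⟩
  rcases eq_or_ne c t with rfl | hct
  · refine ⟨c, hc, ?_⟩
    rw [Finset.sum_range_succ']
    simp
  have hsub : uIcc c t ⊆ s := hs.uIcc_subset hc ht
  have hu : UniqueDiffOn ℝ (uIcc c t) := uniqueDiffOn_Icc (by simpa using hct.symm)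
  have hg : ∀ m < n + 1, ∀ r ∈ uIcc c t, HasDerivWithinAt (g m) (g (m + 1) r) (uIcc c t) r :=
    fun m hm r hr => (h m hm r (hsub hr)).mono hsub
  have hit := iteratedDerivWithin_eqOn_of_hasDerivWithinAt hu hg
  have hdiff : ∀ m < n + 1, DifferentiableOn ℝ (iteratedDerivWithin m (g 0) (uIcc c t)) (uIcc c t) :=
    fun m hm r hr => ((hg m hm r hr).congr (hit m hm.le) (hit m hm.le hr)).differentiableWithinAt
  obtain ⟨ξ, hξ, hr⟩ := taylor_mean_remainder_lagrange (f := g 0) (n := n) hct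
    (contDiffOn_of_differentiableOn_deriv fun m hm => hdiff m (by
      have : m ≤ n := by exact_mod_cast hm
      lia))
    ((hdiff n (by lia)).mono uIoo_subset_uIcc_self)
  have hξ' : ξ ∈ uIcc c t := uIoo_subset_uIcc_self hξ
  refine ⟨ξ, hsub hξ', ?_⟩
  rw [hit _ le_rfl hξ', taylor_within_apply, sub_eq_iff_eq_add] at hr
  rw [hr, add_comm]
  congr 1
  · refine Finset.sum_congr rfl fun m hm => ?_
    rw [hit m (by have := Finset.mem_range.1 hm; lia) left_mem_uIcc, smul_eq_mul]
    ring
  · ring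

end TimeDerivatives

/-! ### Lie derivatives and bounds for the time derivatives of the constraint -/

section LieDerivative

open Set

variable {E V : Type*} [NormedAddCommGroup E] [NormedSpace ℝ E]
  [NormedAddCommGroup V] [NormedSpace ℝ V]

/-- The iterated Lie derivatives of `g` along the vector field `f (·, u)`. -/
noncomputable def lieIter (f : E × V → E) (g : E × V → ℝ) : ℕ → E × V → ℝ
  | 0 => g
  | m + 1 => fun p => fderiv ℝ (lieIter f g m) p (f p, 0)

/-- Each Lie derivative costs one order of smoothness, so orders below `q` remain `C¹`. -/
theorem contDiff_lieIter {f : E × V → E} {g : E × V → ℝ} {q : ℕ} (hf : ContDiff ℝ q f)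
    (hg : ContDiff ℝ q g) : ∀ m ≤ q, ContDiff ℝ (q - m : ℕ) (lieIter f g m) := by
  intro m
  induction m with
  | zero => intro _; simpa [lieIter] using hg
  | succ m ih =>
    intro hm
    refine ((ih (by lia)).fderiv_right (m := (q - (m + 1) : ℕ)) ?_).clm_apply
      ((hf.of_le ?_).prodMk contDiff_const)
    · exact_mod_cast (by lia : q - (m + 1) + 1 ≤ q - m)
    · exact_mod_cast (by lia : q - (m + 1) ≤ q)

theorem contDiff_one_lieIter {f : E × V → E} {g : E × V → ℝ} {q m : ℕ} (hf : ContDiff ℝ q f)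
    (hg : ContDiff ℝ q g) (hm : m < q) : ContDiff ℝ 1 (lieIter f g m) :=
  (contDiff_lieIter hf hg m hm.le).of_le (by exact_mod_cast (by lia : 1 ≤ q - m))

end LieDerivative

namespace DynProblem

open Set Metric Filter Topology

variable {nx nu nh : ℕ} {P : DynProblem nx nu nh} {q : ℕ}

theorem IsTrajectory.hasDerivWithinAt_lieIter
    (hf : ContDiff ℝ q fun p : Vec nx × Vec nu => P.f p.1 p.2)
    (hh : ContDiff ℝ q fun p : Vec nx × Vec nu => P.h p.1 p.2) (i : Fin nh) {u : Vec nu}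
    {x : ℝ → Vec nx} (hx : P.IsTrajectory u x) {m : ℕ} (hm : m < q) {t : ℝ} (ht : t ∈ P.horizon) :
    HasDerivWithinAt (fun s => lieIter (fun p => P.f p.1 p.2) (fun p => P.h p.1 p.2 i) m (x s, u))
      (lieIter (fun p => P.f p.1 p.2) (fun p => P.h p.1 p.2 i) (m + 1) (x t, u)) P.horizon t := by
  have hh' : ContDiff ℝ q fun p : Vec nx × Vec nu => P.h p.1 p.2 i := (contDiff_euclidean.1 hh) i
  exact ((contDiff_one_lieIter hf hh' hm).differentiable one_ne_zero
    (x t, u)).hasFDerivAt.comp_hasDerivWithinAt t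
      ((hx.2 t ht).prodMk (hasDerivWithinAt_const t _ u))

/-- Expresses time derivatives by a fixed function of state and control, reducing regularity in `u`
to that of the trajectory. -/
theorem IsTrajectory.pathDeriv_eqOn (htime : P.t₀ < P.tf)
    (hf : ContDiff ℝ q fun p : Vec nx × Vec nu => P.f p.1 p.2)
    (hh : ContDiff ℝ q fun p : Vec nx × Vec nu => P.h p.1 p.2) (i : Fin nh) {u : Vec nu}
    (hx : P.IsTrajectory u (P.traj u)) {m : ℕ} (hm : m ≤ q) :
    EqOn (P.pathDeriv i m u)
      (fun t => lieIter (fun p => P.f p.1 p.2) (fun p => P.h p.1 p.2 i) m (P.traj u t, u))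
      P.horizon :=
  iteratedDerivWithin_eqOn_of_hasDerivWithinAt (uniqueDiffOn_Icc htime)
    (g := fun m t => lieIter (fun p => P.f p.1 p.2) (fun p => P.h p.1 p.2 i) m (P.traj u t, u))
    (fun _ hm _ ht => hx.hasDerivWithinAt_lieIter hf hh i hm ht) m hm

theorem IsTrajectory.hasDerivWithinAt_pathDeriv (htime : P.t₀ < P.tf)
    (hf : ContDiff ℝ q fun p : Vec nx × Vec nu => P.f p.1 p.2)
    (hh : ContDiff ℝ q fun p : Vec nx × Vec nu => P.h p.1 p.2) (i : Fin nh) {u : Vec nu}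
    (hx : P.IsTrajectory u (P.traj u)) {m : ℕ} (hm : m < q) {t : ℝ} (ht : t ∈ P.horizon) :
    HasDerivWithinAt (P.pathDeriv i m u) (P.pathDeriv i (m + 1) u t) P.horizon t := by
  rw [hx.pathDeriv_eqOn htime hf hh i hm ht]
  exact (hx.hasDerivWithinAt_lieIter hf hh i hm ht).congr
    (hx.pathDeriv_eqOn htime hf hh i hm.le) (hx.pathDeriv_eqOn htime hf hh i hm.le ht)

@[simp]
theorem pathDeriv_zero (i : Fin nh) (u : Vec nu) (t : ℝ) : P.pathDeriv i 0 u t = P.path i u t := by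
  simp [pathDeriv]

/-- The values and the gradients of the time derivatives of order less than `q` of the path
constraint are bounded by `D` on `U × I`. -/
def PathDerivBound (P : DynProblem nx nu nh) (q : ℕ) (D : ℝ) : Prop :=
  ∀ i, ∀ m < q, ∀ u ∈ P.U, ∀ t ∈ P.horizon, |P.pathDeriv i m u t| ≤ D ∧
    DifferentiableAt ℝ (fun v => P.pathDeriv i m v t) u ∧
    ‖fderiv ℝ (fun v => P.pathDeriv i m v t) u‖ ≤ D

theorem exists_bound_pathDeriv_of_lt (htime : P.t₀ < P.tf) (hU : IsCompact P.U)
    (hf : ContDiff ℝ q fun p : Vec nx × Vec nu => P.f p.1 p.2)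
    (hh : ContDiff ℝ q fun p : Vec nx × Vec nu => P.h p.1 p.2) (hgrowth : P.LinearGrowth)
    (i : Fin nh) {m : ℕ} (hm : m < q) :
    ∃ D, ∀ u ∈ P.U, ∀ t ∈ P.horizon, |P.pathDeriv i m u t| ≤ D ∧
      DifferentiableAt ℝ (fun v => P.pathDeriv i m v t) u ∧
      ‖fderiv ℝ (fun v => P.pathDeriv i m v t) u‖ ≤ D := by
  have hf1 : ContDiff ℝ 1 fun p : Vec nx × Vec nu => P.f p.1 p.2 :=
    hf.of_le (by exact_mod_cast (by lia : 1 ≤ q))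
  obtain ⟨C, hC0, htr, hC⟩ := hgrowth.exists_bound_traj htime.le hU hf1
  set G := lieIter (fun p : Vec nx × Vec nu => P.f p.1 p.2) (fun p => P.h p.1 p.2 i) m with hG
  have hG1 : ContDiff ℝ 1 G := contDiff_one_lieIter hf ((contDiff_euclidean.1 hh) i) hm
  have hcpt : IsCompact (closedBall (0 : Vec nx) C ×ˢ P.U) := (isCompact_closedBall _ _).prod hU
  obtain ⟨M, hM⟩ := hcpt.exists_bound_of_continuousOn hG1.continuous.continuousOn
  obtain ⟨N, hN⟩ := hcpt.exists_bound_of_continuousOn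
    (hG1.continuous_fderiv one_ne_zero).continuousOn
  refine ⟨max M (N * max C 1), fun u hu t ht => ?_⟩
  obtain ⟨h1, h2, h3⟩ := hC u hu t ht
  have hmem : (P.traj u t, u) ∈ closedBall (0 : Vec nx) C ×ˢ P.U :=
    ⟨mem_closedBall_zero_iff.2 h1, hu⟩
  -- The identity is needed on a full neighbourhood of `u`, possibly leaving `U`; hence the
  -- existence of trajectories near `U`.
  have hev : (fun v => P.pathDeriv i m v t) =ᶠ[𝓝 u] fun v => G (P.traj v t, v) :=
    (htr u hu).mono fun v hv => hv.pathDeriv_eqOn htime hf hh i hm.le ht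
  have hd : HasFDerivAt (fun v => P.pathDeriv i m v t)
      ((fderiv ℝ G (P.traj u t, u)).comp ((fderiv ℝ (fun v => P.traj v t) u).prod
        (ContinuousLinearMap.id ℝ (Vec nu)))) u :=
    (HasFDerivAt.comp (f := fun v => (P.traj v t, v)) u
      (hG1.differentiable one_ne_zero (P.traj u t, u)).hasFDerivAt
      (h2.hasFDerivAt.prodMk (hasFDerivAt_id u))).congr_of_eventuallyEq hev
  refine ⟨?_, hd.differentiableAt, ?_⟩
  · have := hev.self_of_nhds
    beta_reduce at this
    rw [this]
    exact (hM _ hmem).trans (le_max_left _ _)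
  · rw [hd.fderiv]
    refine (ContinuousLinearMap.opNorm_comp_le _ _).trans (le_trans ?_ (le_max_right _ _))
    refine mul_le_mul (hN _ hmem) ?_ (norm_nonneg _) ((norm_nonneg _).trans (hN _ hmem))
    rw [ContinuousLinearMap.opNorm_prod, Prod.norm_mk]
    exact max_le_max h3 ContinuousLinearMap.norm_id_le

theorem exists_pathDerivBound (htime : P.t₀ < P.tf) (hU : IsCompact P.U)
    (hf : ContDiff ℝ q fun p : Vec nx × Vec nu => P.f p.1 p.2)
    (hh : ContDiff ℝ q fun p : Vec nx × Vec nu => P.h p.1 p.2) (hgrowth : P.LinearGrowth) :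
    ∃ D, 0 ≤ D ∧ P.PathDerivBound q D := by
  choose D hD using fun z : Fin nh × Fin q =>
    exists_bound_pathDeriv_of_lt htime hU hf hh hgrowth z.1 z.2.2
  obtain ⟨M, hM⟩ := Finite.bddAbove_range D
  refine ⟨max M 0, le_max_right _ _, fun i m hm u hu t ht => ?_⟩
  obtain ⟨h1, h2, h3⟩ := hD (i, ⟨m, hm⟩) u hu t ht
  have hle : D (i, ⟨m, hm⟩) ≤ max M 0 := (hM ⟨_, rfl⟩).trans (le_max_left _ _)
  exact ⟨h1.trans hle, h2, h3.trans hle⟩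

end DynProblem

/-! ### Bernstein form of polynomials -/

section BernsteinForm

open Finset

/-- The Bernstein form of a monomial. -/
theorem sum_choose_div_choose_mul_bernstein {r l : ℕ} (hl : l ≤ r) (τ : ℝ) :
    ∑ j ∈ range (r + 1), ((j.choose l : ℝ) / (r.choose l : ℝ)) *
      ((r.choose j : ℝ) * τ ^ j * (1 - τ) ^ (r - j)) = τ ^ l := by
  obtain ⟨n, rfl⟩ := Nat.exists_eq_add_of_le hl
  -- Terms with `j < l` vanish; for `j = l + k`, trading binomial coefficients reduces the rest to
  -- the binomial theorem.
  rw [add_assoc, sum_range_add, sum_eq_zero, zero_add]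
  · have h : ∀ k ∈ range (n + 1), (((l + k).choose l : ℝ) / ((l + n).choose l : ℝ)) *
        (((l + n).choose (l + k) : ℝ) * τ ^ (l + k) * (1 - τ) ^ (l + n - (l + k))) =
        τ ^ l * (τ ^ k * (1 - τ) ^ (n - k) * (n.choose k : ℝ)) := fun k hk => by
      have hkn : k ≤ n := by simpa [Nat.lt_succ_iff] using hk
      have h1 : ((l + n).choose (l + k) : ℝ) * ((l + k).choose l : ℝ) =
          ((l + n).choose l : ℝ) * (n.choose k : ℝ) := by
        have := Nat.choose_mul (n := l + n) (k := l + k) (s := l) (by lia)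
        rw [Nat.add_sub_cancel_left, Nat.add_sub_cancel_left] at this
        exact_mod_cast this
      have h2 : ((l + n).choose l : ℝ) ≠ 0 := by
        exact_mod_cast (Nat.choose_pos (by lia)).ne'
      rw [Nat.add_sub_add_left, div_mul_eq_mul_div, div_eq_iff h2, pow_add]
      linear_combination (τ ^ l * τ ^ k * (1 - τ) ^ (n - k)) * h1
    rw [sum_congr rfl h, ← mul_sum, ← add_pow]
    simp
  · intro j hj
    rw [Nat.choose_eq_zero_of_lt (mem_range.1 hj)]
    simp

/-- A polynomial of degree less than `q ≤ r + 1` is bounded on `[0, 1]` by any bound of its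
Bernstein coefficients of degree `r`. -/
theorem Polynomial.eval_le_of_bernstein_le {p : Polynomial ℝ} {q r : ℕ} (hp : p.natDegree < q)
    (hqr : q ≤ r + 1) {M τ : ℝ}
    (hM : ∀ j ≤ r, ∑ l ∈ range q, p.coeff l * ((j.choose l : ℝ) / (r.choose l : ℝ)) ≤ M)
    (h0 : 0 ≤ τ) (h1 : τ ≤ 1) : p.eval τ ≤ M := by
  -- On `[0, 1]` the Bernstein basis consists of nonnegative weights with sum `1`, so the value is
  -- an average of the coefficients.
  have hw : ∀ j, 0 ≤ (r.choose j : ℝ) * τ ^ j * (1 - τ) ^ (r - j) := fun j => by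
    have := sub_nonneg.2 h1
    positivity
  have hsum : ∑ j ∈ range (r + 1), (r.choose j : ℝ) * τ ^ j * (1 - τ) ^ (r - j) = 1 := by
    simpa using sum_choose_div_choose_mul_bernstein (Nat.zero_le r) τ
  calc p.eval τ = ∑ l ∈ range q, p.coeff l * τ ^ l := p.eval_eq_sum_range' hp τ
    _ = ∑ l ∈ range q, ∑ j ∈ range (r + 1), p.coeff l *
        (((j.choose l : ℝ) / (r.choose l : ℝ)) *
          ((r.choose j : ℝ) * τ ^ j * (1 - τ) ^ (r - j))) := by
      refine sum_congr rfl fun l hl => ?_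
      rw [← mul_sum, sum_choose_div_choose_mul_bernstein (by have := mem_range.1 hl; lia)]
    _ = ∑ j ∈ range (r + 1), (∑ l ∈ range q, p.coeff l *
        ((j.choose l : ℝ) / (r.choose l : ℝ))) *
          ((r.choose j : ℝ) * τ ^ j * (1 - τ) ^ (r - j)) := by
      rw [sum_comm]
      refine sum_congr rfl fun j _ => ?_
      rw [sum_mul]
      exact sum_congr rfl fun l _ => (mul_assoc _ _ _).symm
    _ ≤ ∑ j ∈ range (r + 1), M * ((r.choose j : ℝ) * τ ^ j * (1 - τ) ^ (r - j)) :=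
      sum_le_sum fun j hj => mul_le_mul_of_nonneg_right
        (hM j (Nat.lt_succ_iff.1 (mem_range.1 hj))) (hw j)
    _ = M := by rw [← mul_sum, hsum, mul_one]

end BernsteinForm

/-! ### The smooth maximum -/

section LogSumExp

open Finset Real

theorem le_log_sum_exp {ι : Type*} {s : Finset ι} {ρ : ℝ} (hρ : 0 < ρ) (b : ι → ℝ) {j : ι}
    (hj : j ∈ s) : b j ≤ 1 / ρ * log (∑ j ∈ s, exp (ρ * b j)) := by
  rw [one_div, ← div_eq_inv_mul, le_div_iff₀ hρ, mul_comm, le_log_iff_exp_le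
    (sum_pos (fun _ _ => exp_pos _) ⟨j, hj⟩)]
  exact single_le_sum (f := fun j => exp (ρ * b j)) (fun _ _ => (exp_pos _).le) hj

theorem log_sum_exp_le {ι : Type*} {s : Finset ι} (hs : s.Nonempty) {ρ : ℝ} (hρ : 0 < ρ)
    {b : ι → ℝ} {M : ℝ} (hb : ∀ j ∈ s, b j ≤ M) :
    1 / ρ * log (∑ j ∈ s, exp (ρ * b j)) ≤ M + log s.card / ρ := by
  have h1 : ∑ j ∈ s, exp (ρ * b j) ≤ s.card * exp (ρ * M) := by
    rw [← nsmul_eq_mul]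
    exact sum_le_card_nsmul _ _ _ fun j hj => exp_le_exp.2 (by have := hb j hj; gcongr)
  have hc : (0 : ℝ) < s.card := by exact_mod_cast hs.card_pos
  have h2 := log_le_log (sum_pos (fun _ _ => exp_pos _) hs) h1
  rw [log_mul hc.ne' (exp_pos _).ne', log_exp] at h2
  rw [one_div, ← div_eq_inv_mul, div_le_iff₀ hρ, add_mul, div_mul_cancel₀ _ hρ.ne']
  linarith

/-- If the derivatives of all `b j` are close to `L`, so is the derivative of their smooth
maximum. -/
theorem exists_hasFDerivAt_log_sum_exp {ι V : Type*} [NormedAddCommGroup V] [NormedSpace ℝ V]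
    {s : Finset ι} (hs : s.Nonempty) {ρ ε : ℝ} (hρ : 0 < ρ) {b : ι → V → ℝ}
    {b' : ι → V →L[ℝ] ℝ} {L : V →L[ℝ] ℝ} {u : V} (hb : ∀ j ∈ s, HasFDerivAt (b j) (b' j) u)
    (hL : ∀ j ∈ s, ‖b' j - L‖ ≤ ε) :
    ∃ H : V →L[ℝ] ℝ, HasFDerivAt (fun v => 1 / ρ * log (∑ j ∈ s, exp (ρ * b j v))) H u ∧
      ‖H - L‖ ≤ ε := by
  set S := ∑ j ∈ s, exp (ρ * b j u) with hS
  have hS0 : 0 < S := sum_pos (fun _ _ => exp_pos _) hs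
  have h1 : HasFDerivAt (fun v => ∑ j ∈ s, exp (ρ * b j v))
      (∑ j ∈ s, exp (ρ * b j u) • ρ • b' j) u :=
    HasFDerivAt.fun_sum fun j hj => ((hb j hj).const_mul ρ).exp
  refine ⟨_, (h1.log hS0.ne').const_mul (1 / ρ), ?_⟩
  -- The factor `ρ` cancels, leaving the mean of the `b' j` with weights `exp (ρ * b j u) / S`;
  -- subtracting `L` commutes with averaging.
  have h2 : (1 / ρ) • S⁻¹ • ∑ j ∈ s, exp (ρ * b j u) • ρ • b' j - L =
      S⁻¹ • ∑ j ∈ s, exp (ρ * b j u) • (b' j - L) := by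
    have h3 : L = S⁻¹ • ∑ j ∈ s, exp (ρ * b j u) • L := by
      rw [← sum_smul, ← hS, smul_smul, inv_mul_cancel₀ hS0.ne', one_smul]
    conv_lhs => rw [h3]
    simp only [smul_sub, sum_sub_distrib]
    congr 1
    rw [smul_comm, smul_sum]
    congr 1
    refine sum_congr rfl fun j _ => ?_
    rw [smul_comm, smul_smul (1 / ρ), one_div, inv_mul_cancel₀ hρ.ne', one_smul]
  rw [h2, norm_smul, norm_inv, norm_of_nonneg hS0.le, inv_mul_le_iff₀ hS0, hS, sum_mul]
  refine norm_sum_le_of_le _ fun j hj => ?_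
  rw [norm_smul, norm_of_nonneg (exp_pos _).le]
  exact mul_le_mul_of_nonneg_left (hL j hj) (exp_pos _).le

end LogSumExp

/-- A power sum in `Δ` differs from its constant term by `O(Δ)`. -/
theorem norm_sum_pow_smul_sub_le {F : Type*} [NormedAddCommGroup F] [NormedSpace ℝ F] {q : ℕ}
    (hq : 1 ≤ q) {κ : ℕ → ℝ} (hκ : κ 0 = 1) {y : ℕ → F} {D Δ : ℝ} (hy : ∀ m < q, ‖y m‖ ≤ D)
    (h0 : 0 ≤ Δ) (h1 : Δ ≤ 1) :
    ‖∑ m ∈ Finset.range q, (Δ ^ m * κ m) • y m - y 0‖ ≤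
      (∑ m ∈ Finset.range q, |κ m|) * D * Δ := by
  obtain ⟨n, rfl⟩ : ∃ n, q = n + 1 := ⟨q - 1, by lia⟩
  have hD : 0 ≤ D := (norm_nonneg _).trans (hy 0 (by lia))
  rw [Finset.sum_range_succ', Finset.sum_range_succ', hκ]
  simp only [pow_zero, mul_one, one_smul, add_sub_cancel_right]
  have h2 : ‖∑ m ∈ Finset.range n, (Δ ^ (m + 1) * κ (m + 1)) • y (m + 1)‖ ≤
      ∑ m ∈ Finset.range n, |κ (m + 1)| * (D * Δ) := by
    refine norm_sum_le_of_le _ fun m hm => ?_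
    have h3 : Δ ^ (m + 1) ≤ Δ := pow_le_of_le_one h0 h1 (by lia)
    have h4 := hy (m + 1) (by have := Finset.mem_range.1 hm; lia)
    rw [norm_smul, norm_mul, Real.norm_eq_abs (κ _), Real.norm_of_nonneg (by positivity)]
    calc Δ ^ (m + 1) * |κ (m + 1)| * ‖y (m + 1)‖ ≤ Δ * |κ (m + 1)| * D := by gcongr
      _ = _ := by ring
  rw [← Finset.sum_mul] at h2
  refine h2.trans ?_
  rw [mul_assoc, add_mul]
  have : 0 ≤ |(1 : ℝ)| * (D * Δ) := by positivity
  linarith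

/-! ### The Taylor-Bernstein bound: validity and accuracy -/

namespace DynProblem

open Set Metric Filter Topology

variable {nx nu nh : ℕ} {P : DynProblem nx nu nh} {A : TBParams nh}

theorem eval_taylorPoly (u : Vec nu) (c : Cell nh) (τ : ℝ) :
    (P.taylorPoly A u c).eval τ = ∑ m ∈ Finset.range A.q,
      P.pathDeriv c.comp m u c.mid / m.factorial * (c.width * (τ - 1 / 2)) ^ m := by
  simp [taylorPoly, Polynomial.eval_finsetSum]

theorem natDegree_taylorPoly_lt (hq : 1 ≤ A.q) (u : Vec nu) (c : Cell nh) :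
    (P.taylorPoly A u c).natDegree < A.q := by
  refine (Nat.lt_iff_le_pred hq).2 (Polynomial.natDegree_sum_le_of_forall_le _ _ fun m hm => ?_)
  have hm' := Finset.mem_range.1 hm
  refine (Polynomial.natDegree_C_mul_le _ _).trans ((Polynomial.natDegree_pow_le_of_le m
    ((Polynomial.natDegree_C_mul_le _ _).trans (Polynomial.natDegree_X_sub_C_le _))).trans ?_)
  lia

/-- The truncation at `min j (q - 1)` is automatic, since `j.choose l = 0` for `l > j`. -/
theorem bern_eq_sum_range (hq : 1 ≤ A.q) (u : Vec nu) (c : Cell nh) (j : ℕ) :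
    P.bern A u c j = ∑ l ∈ Finset.range A.q,
      (P.taylorPoly A u c).coeff l * ((j.choose l : ℝ) / (A.r.choose l : ℝ)) := by
  refine Finset.sum_subset (Finset.range_subset_range.2 (by lia)) fun l hl hl' => ?_
  rw [Finset.mem_range] at hl hl'
  rw [Nat.choose_eq_zero_of_lt (by lia)]
  simp

/-- The weights of the time derivatives in the Bernstein coefficients. -/
noncomputable def bernWeight (A : TBParams nh) (j m : ℕ) : ℝ :=
  ∑ l ∈ Finset.range A.q, (((Polynomial.X - Polynomial.C (1 / 2 : ℝ)) ^ m).coeff l *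
    ((j.choose l : ℝ) / (A.r.choose l : ℝ))) / m.factorial

theorem bernWeight_zero (hq : 1 ≤ A.q) (j : ℕ) : bernWeight A j 0 = 1 := by
  rw [bernWeight, Finset.sum_eq_single_of_mem 0 (Finset.mem_range.2 hq)]
  · simp
  · intro l _ hl
    simp [Polynomial.coeff_one, hl]

/-- The weights depend on neither control nor cell, so a single power-sum estimate serves values and
gradients. The leading weight is `1` for every `j`. -/
theorem bern_eq_sum_bernWeight (hq : 1 ≤ A.q) (u : Vec nu) (c : Cell nh) (j : ℕ) :
    P.bern A u c j = ∑ m ∈ Finset.range A.q,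
      (c.width ^ m * bernWeight A j m) • P.pathDeriv c.comp m u c.mid := by
  rw [bern_eq_sum_range hq]
  simp only [taylorPoly, Polynomial.finsetSum_coeff, mul_pow, ← Polynomial.C_pow,
    Polynomial.coeff_C_mul, bernWeight, Finset.mul_sum, Finset.sum_mul, smul_eq_mul]
  rw [Finset.sum_comm]
  refine Finset.sum_congr rfl fun m _ => Finset.sum_congr rfl fun l _ => ?_
  ring

theorem HTB_eq (u : Vec nu) (c : Cell nh) :
    P.HTB A u c = 1 / A.ρ * Real.log (∑ j ∈ Finset.range (A.r + 1),
      Real.exp (A.ρ * P.bern A u c j)) + A.remBound c := rfl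

theorem _root_.TBParams.BU_nonneg (A : TBParams nh) (i : Fin nh) : 0 ≤ A.BU i := by
  unfold TBParams.BU
  split_ifs
  · exact (abs_nonneg _).trans (le_max_left _ _)
  · exact le_max_left _ _

/-- For even `q` the power of `t - c.mid` is nonnegative and only the upper end of the enclosure
matters; for odd `q` its sign varies and absolute values are needed. -/
theorem remainder_le_remBound (hΛ : P.Encloses A) {u : Vec nu} (hu : u ∈ P.U) (c : Cell nh)
    {t ξ : ℝ} (ht : t ∈ Icc c.lo c.hi) (hξ : ξ ∈ P.horizon) :
    P.pathDeriv c.comp A.q u ξ / A.q.factorial * (t - c.mid) ^ A.q ≤ A.remBound c := by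
  have hb := hΛ c.comp u hu ξ hξ
  have habs : |t - c.mid| ≤ c.width / 2 := by
    rw [abs_le]; unfold Cell.mid Cell.width; constructor <;> linarith [ht.1, ht.2]
  have hpow : |t - c.mid| ^ A.q ≤ (c.width / 2) ^ A.q := by gcongr
  have hmain : P.pathDeriv c.comp A.q u ξ * (t - c.mid) ^ A.q ≤
      (c.width / 2) ^ A.q * A.BU c.comp := by
    have hB := A.BU_nonneg c.comp
    refine le_trans ?_ (mul_le_mul_of_nonneg_right hpow hB)
    rcases Nat.even_or_odd A.q with he | ho
    · rw [he.pow_abs, mul_comm]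
      refine mul_le_mul_of_nonneg_left ?_ (he.pow_nonneg _)
      rw [TBParams.BU, if_neg (Nat.not_odd_iff_even.2 he)]
      exact hb.2.trans (le_max_right _ _)
    · refine (le_abs_self _).trans ?_
      rw [abs_mul, abs_pow, mul_comm]
      refine mul_le_mul_of_nonneg_left ?_ (by positivity)
      rw [TBParams.BU, if_pos ho]
      exact abs_le_max_abs_abs hb.1 hb.2
  have hfac : (0 : ℝ) < A.q.factorial := by exact_mod_cast A.q.factorial_pos
  rw [TBParams.remBound, div_mul_eq_mul_div, mul_assoc, one_div, ← div_eq_inv_mul]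
  gcongr

/-- `H_TB` is an upper bound of the path constraint on the cell. -/
theorem path_le_HTB (hq : 1 ≤ A.q) (hr : A.q ≤ A.r + 1) (hρ : 0 < A.ρ) (hΛ : P.Encloses A)
    {u : Vec nu} (hu : u ∈ P.U) {c : Cell nh} (hc : c.lo < c.hi)
    (hcI : Icc c.lo c.hi ⊆ P.horizon)
    (hd : ∀ m < A.q, ∀ t ∈ P.horizon,
      HasDerivWithinAt (P.pathDeriv c.comp m u) (P.pathDeriv c.comp (m + 1) u t) P.horizon t)
    {t : ℝ} (ht : t ∈ Icc c.lo c.hi) : P.path c.comp u t ≤ P.HTB A u c := by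
  have hw : 0 < c.width := sub_pos.2 hc
  have hmid : c.mid ∈ Icc c.lo c.hi := by
    unfold Cell.mid; constructor <;> linarith
  obtain ⟨ξ, hξ, hT⟩ := exists_taylor_lagrange_of_hasDerivWithinAt (hs := ordConnected_Icc) hq hd
    (hcI hmid) (hcI ht)
  rw [pathDeriv_zero] at hT
  rw [hT, HTB_eq]
  refine add_le_add ?_ (remainder_le_remBound hΛ hu c ht hξ)
  have hτ : c.width * ((t - c.lo) / c.width - 1 / 2) = t - c.mid := by
    rw [mul_sub, mul_div_cancel₀ _ hw.ne']; unfold Cell.mid Cell.width; ring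
  rw [← hτ, ← eval_taylorPoly]
  refine Polynomial.eval_le_of_bernstein_le (natDegree_taylorPoly_lt hq u c) hr (fun j hj => ?_)
    (div_nonneg (sub_nonneg.2 ht.1) hw.le)
    ((div_le_one hw).2 (by unfold Cell.width; linarith [ht.2]))
  rw [← bern_eq_sum_range hq]
  exact le_log_sum_exp hρ (P.bern A u c) (Finset.mem_range.2 (by lia))

/-- On short cells both `H_TB` and its gradient are close to the path constraint at the midpoint,
up to the smoothing bias `δ`. -/
theorem exists_HTB_sub_path_le (hq : 1 ≤ A.q) (hρ : 0 < A.ρ) {D : ℝ} (hD0 : 0 ≤ D)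
    (hD : P.PathDerivBound A.q D) :
    ∃ C, 0 ≤ C ∧ ∀ u ∈ P.U, ∀ c : Cell nh, c.mid ∈ P.horizon → 0 ≤ c.width → c.width ≤ 1 →
      P.HTB A u c ≤ P.path c.comp u c.mid + A.δ + C * c.width ∧
      ‖gradient (fun v => P.HTB A v c) u - gradient (fun v => P.path c.comp v c.mid) u‖ ≤
        C * c.width := by
  set W : ℝ := ∑ j ∈ Finset.range (A.r + 1), ∑ m ∈ Finset.range A.q, |bernWeight A j m| with hW
  have hWj : ∀ j ∈ Finset.range (A.r + 1), ∑ m ∈ Finset.range A.q, |bernWeight A j m| ≤ W :=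
    fun j hj => Finset.single_le_sum (f := fun j => ∑ m ∈ Finset.range A.q, |bernWeight A j m|)
      (fun _ _ => Finset.sum_nonneg fun _ _ => abs_nonneg _) hj
  have hW0 : 0 ≤ W := Finset.sum_nonneg fun _ _ => Finset.sum_nonneg fun _ _ => abs_nonneg _
  set B : ℝ := ∑ i, A.BU i with hB
  have hB0 : 0 ≤ B := Finset.sum_nonneg fun i _ => A.BU_nonneg i
  -- `W * D` controls the Bernstein coefficients and their gradients. `B` controls the remainder, as
  -- `(Δ / 2) ^ q ≤ Δ`; being constant in `u`, it drops out of the gradient.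
  refine ⟨W * D + B, by positivity, fun u hu c hmid h0 h1 => ?_⟩
  have hne : (Finset.range (A.r + 1)).Nonempty := Finset.nonempty_range_add_one
  have hmono : ∀ j ∈ Finset.range (A.r + 1),
      (∑ m ∈ Finset.range A.q, |bernWeight A j m|) * D * c.width ≤ W * D * c.width := fun j hj => by
    have := hWj j hj
    gcongr
  constructor
  · have hb : ∀ j ∈ Finset.range (A.r + 1),
        P.bern A u c j ≤ P.path c.comp u c.mid + W * D * c.width := fun j hj => by
      have h := norm_sum_pow_smul_sub_le hq (bernWeight_zero hq j)
        (y := fun m => P.pathDeriv c.comp m u c.mid) (D := D)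
        (fun m hm => (hD c.comp m hm u hu c.mid hmid).1) h0 h1
      rw [← bern_eq_sum_bernWeight hq, pathDeriv_zero] at h
      linarith [le_abs_self (P.bern A u c j - P.path c.comp u c.mid), hmono j hj, h,
        Real.norm_eq_abs (P.bern A u c j - P.path c.comp u c.mid)]
    have h := log_sum_exp_le hne hρ hb
    rw [Finset.card_range] at h
    have hrem : A.remBound c ≤ B * c.width := by
      have hBi : A.BU c.comp ≤ B :=
        Finset.single_le_sum (f := A.BU) (fun i _ => A.BU_nonneg i) (Finset.mem_univ _)
      have hfac : 1 / (A.q.factorial : ℝ) ≤ 1 := by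
        rw [div_le_one (by exact_mod_cast A.q.factorial_pos)]
        exact_mod_cast A.q.factorial_pos
      have hp : (c.width / 2) ^ A.q ≤ c.width :=
        (pow_le_of_le_one (by linarith) (by linarith) (by lia)).trans (by linarith)
      have hBU := A.BU_nonneg c.comp
      calc A.remBound c ≤ 1 * c.width * B := by unfold TBParams.remBound; gcongr
        _ = _ := by ring
    rw [HTB_eq, TBParams.δ]
    push_cast at h
    linarith
  · have hL := (hD c.comp 0 hq u hu c.mid hmid).2.1
    obtain ⟨H, hH, hHL⟩ := exists_hasFDerivAt_log_sum_exp hne hρ (u := u)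
      (b := fun j v => P.bern A v c j)
      (b' := fun j => ∑ m ∈ Finset.range A.q, (c.width ^ m * bernWeight A j m) •
        fderiv ℝ (fun v => P.pathDeriv c.comp m v c.mid) u)
      (L := fderiv ℝ (fun v => P.pathDeriv c.comp 0 v c.mid) u) (ε := W * D * c.width)
      (fun j _ => by
        simp only [bern_eq_sum_bernWeight hq]
        exact HasFDerivAt.fun_sum fun m hm =>
          (hD c.comp m (Finset.mem_range.1 hm) u hu c.mid hmid).2.1.hasFDerivAt.const_smul
            (c.width ^ m * bernWeight A j m))
      (fun j hj => (norm_sum_pow_smul_sub_le hq (bernWeight_zero hq j) (D := D)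
        (fun m hm => (hD c.comp m hm u hu c.mid hmid).2.2) h0 h1).trans (hmono j hj))
    have hH' : fderiv ℝ (fun v => P.HTB A v c) u = H := (hH.add_const (A.remBound c)).fderiv
    simp only [pathDeriv_zero] at hHL
    rw [gradient, gradient, ← map_sub, LinearIsometryEquiv.norm_map, hH']
    refine hHL.trans ?_
    gcongr
    linarith

end DynProblem

/-! ### Refinement of cells and the potential argument -/

section Refinement

namespace Cell

open Set

variable {nh : ℕ}

theorem mem_split {N : ℕ} {c d : Cell nh} : d ∈ c.split N ↔ ∃ k < N,
    (c.comp, c.lo + k * (c.width / N), c.lo + (k + 1) * (c.width / N)) = d := by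
  simp [split]

theorem comp_of_mem_split {N : ℕ} {c d : Cell nh} (hd : d ∈ c.split N) : d.comp = c.comp := by
  obtain ⟨k, -, rfl⟩ := mem_split.1 hd
  rfl

theorem width_of_mem_split {N : ℕ} {c d : Cell nh} (hd : d ∈ c.split N) :
    d.width = c.width / N := by
  obtain ⟨k, -, rfl⟩ := mem_split.1 hd
  change c.lo + (k + 1) * (c.width / N) - (c.lo + k * (c.width / N)) = _
  ring

theorem card_split_le (N : ℕ) (c : Cell nh) : (c.split N).card ≤ N :=
  Finset.card_image_le.trans (Finset.card_range N).le

theorem Icc_subset_of_mem_split {N : ℕ} {c d : Cell nh} (hc : c.lo ≤ c.hi) (hd : d ∈ c.split N) :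
    Icc d.lo d.hi ⊆ Icc c.lo c.hi := by
  obtain ⟨k, hk, rfl⟩ := mem_split.1 hd
  have hw : 0 ≤ c.width := sub_nonneg.2 hc
  have hN : (0 : ℝ) < N := by exact_mod_cast (by lia : 0 < N)
  have hk' : (k : ℝ) + 1 ≤ N := by exact_mod_cast hk
  refine Icc_subset_Icc (le_add_of_nonneg_right (by positivity)) ?_
  change c.lo + (k + 1) * (c.width / N) ≤ c.hi
  have h1 : (k + 1) * (c.width / N) ≤ N * (c.width / N) := by gcongr
  rw [mul_div_cancel₀ _ hN.ne'] at h1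
  unfold width at *
  linarith

theorem exists_mem_split {N : ℕ} (hN : 1 ≤ N) {c : Cell nh} (hc : c.lo < c.hi) {t : ℝ}
    (ht : t ∈ Icc c.lo c.hi) : ∃ d ∈ c.split N, t ∈ Icc d.lo d.hi := by
  have hN' : (0 : ℝ) < N := by exact_mod_cast hN
  have hw : 0 < c.width := sub_pos.2 hc
  set e := c.width / N with he
  have he0 : 0 < e := by positivity
  have hNe : N * e = c.hi - c.lo := by rw [he, mul_div_cancel₀ _ hN'.ne', width]
  have hx0 : 0 ≤ (t - c.lo) / e := div_nonneg (sub_nonneg.2 ht.1) he0.le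
  have hxt : (t - c.lo) / e * e = t - c.lo := div_mul_cancel₀ _ he0.ne'
  -- The index is the floor of the relative position, except at the right end point, which goes to
  -- the last part.
  obtain ⟨k, hk, h1, h2⟩ : ∃ k < N, (k : ℝ) ≤ (t - c.lo) / e ∧ (t - c.lo) / e ≤ k + 1 := by
    by_cases h : ⌊(t - c.lo) / e⌋₊ < N
    · exact ⟨_, h, Nat.floor_le hx0, (Nat.lt_floor_add_one _).le⟩
    · have hle : (N : ℝ) ≤ (t - c.lo) / e :=
        le_trans (by exact_mod_cast not_lt.1 h) (Nat.floor_le hx0)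
      have hcast : ((N - 1 : ℕ) : ℝ) = N - 1 := by push_cast [hN]; ring
      refine ⟨N - 1, by lia, by rw [hcast]; linarith, ?_⟩
      rw [hcast, sub_add_cancel, div_le_iff₀ he0, hNe]
      linarith [ht.2]
  refine ⟨_, mem_split.2 ⟨k, hk, rfl⟩, ?_, ?_⟩
  · change c.lo + k * e ≤ t
    nlinarith
  · change t ≤ c.lo + (k + 1) * e
    nlinarith

/-- `C'` arises from `C` by dividing the cells in `S ⊆ C` into at least two equal parts each. -/
def IsRefinement (S C C' : Finset (Cell nh)) : Prop :=
  S ⊆ C ∧ ∃ N : Cell nh → ℕ, (∀ c, 2 ≤ N c) ∧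
    ∀ d, d ∈ C' ↔ (∃ c ∈ S, d ∈ c.split (N c)) ∨ (d ∈ C ∧ d ∉ S)

/-- The cells are nondegenerate, contained in `I`, and cover `I` for every component. -/
def Covers (I : Set ℝ) (C : Finset (Cell nh)) : Prop :=
  (∀ c ∈ C, c.lo < c.hi ∧ Icc c.lo c.hi ⊆ I) ∧
    ∀ i, ∀ t ∈ I, ∃ c ∈ C, c.comp = i ∧ t ∈ Icc c.lo c.hi

theorem Covers.of_isRefinement {I : Set ℝ} {S C C' : Finset (Cell nh)} (hC : Covers I C)
    (h : IsRefinement S C C') : Covers I C' := by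
  obtain ⟨hS, N, hN, hmem⟩ := h
  constructor
  · intro d hd
    rcases (hmem d).1 hd with ⟨c, hc, hdc⟩ | ⟨hd, -⟩
    · obtain ⟨h1, h2⟩ := hC.1 c (hS hc)
      refine ⟨?_, (Icc_subset_of_mem_split h1.le hdc).trans h2⟩
      have hN0 : (0 : ℝ) < N c := by exact_mod_cast (by have := hN c; lia : 0 < N c)
      have hw : 0 < d.width := by
        rw [width_of_mem_split hdc]
        exact div_pos (sub_pos.2 h1) hN0
      exact sub_pos.1 hw
    · exact hC.1 d hd
  · intro i t ht
    obtain ⟨c, hc, hci, htc⟩ := hC.2 i t ht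
    by_cases hcS : c ∈ S
    · obtain ⟨d, hd, htd⟩ := exists_mem_split (N := N c) (by have := hN c; lia) (hC.1 c hc).1 htc
      exact ⟨d, (hmem d).2 (Or.inl ⟨c, hcS, hd⟩), (comp_of_mem_split hd).trans hci, htd⟩
    · exact ⟨c, (hmem c).2 (Or.inr ⟨hc, hcS⟩), hci, htc⟩

/-- Dividing an interval of length `w > η` into at least two equal parts decreases the sum of the
values of this function by at least `1`. -/
noncomputable def potential (η w : ℝ) : ℝ := if η < w then 2 * w / η - 1 else 0

theorem potential_nonneg {η : ℝ} (hη : 0 < η) (w : ℝ) : 0 ≤ potential η w := by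
  unfold potential
  split_ifs with h
  · have : 1 ≤ w / η := (one_le_div hη).2 h.le
    rw [mul_div_assoc]
    linarith
  · exact le_rfl

/-- If the parts are still wider than `η`, the term `-1` now counts `N ≥ 2` times; if only the whole
is wider, a value of at least `1` drops to `0`. -/
theorem mul_potential_div_add_le {η w : ℝ} (hη : 0 < η) (hw : 0 ≤ w) {N : ℕ} (hN : 2 ≤ N) :
    N * potential η (w / N) + (if η < w then 1 else 0) ≤ potential η w := by
  have hN' : (2 : ℝ) ≤ N := by exact_mod_cast hN
  have hdiv : w / N ≤ w := div_le_self hw (by linarith)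
  unfold potential
  split_ifs with h1 h2 h2
  · have : N * (2 * (w / N) / η - 1) = 2 * w / η - N := by field_simp
    linarith
  · linarith
  · have : 1 ≤ w / η := (one_le_div hη).2 h2.le
    rw [mul_div_assoc]
    linarith
  · simp

theorem _root_.Finset.sum_biUnion_le_sum {α β : Type*} [DecidableEq β] (S : Finset α)
    (t : α → Finset β) {g : β → ℝ} (hg : ∀ b, 0 ≤ g b) :
    ∑ b ∈ S.biUnion t, g b ≤ ∑ a ∈ S, ∑ b ∈ t a, g b := by
  classical
  induction S using Finset.induction_on with
  | empty => simp
  | insert a S ha ih =>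
    rw [Finset.biUnion_insert, Finset.sum_insert ha]
    have h1 := Finset.sum_union_inter (s₁ := t a) (s₂ := S.biUnion t) (f := g)
    have h2 : 0 ≤ ∑ b ∈ t a ∩ S.biUnion t, g b := Finset.sum_nonneg fun b _ => hg b
    linarith

/-- No division raises the potential, and each divided wide cell lowers it by `1`. Coinciding parts
only help, the potential being nonnegative. -/
theorem IsRefinement.sum_potential_add_one_le {S C C' : Finset (Cell nh)}
    (h : IsRefinement S C C') (hC : ∀ c ∈ C, c.lo < c.hi) {η : ℝ} (hη : 0 < η)
    (hlarge : ∃ c ∈ S, η < c.width) :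
    ∑ c ∈ C', potential η c.width + 1 ≤ ∑ c ∈ C, potential η c.width := by
  classical
  obtain ⟨hS, N, hN, hmem⟩ := h
  have hC' : C' = S.biUnion (fun c => c.split (N c)) ∪ (C \ S) := by
    ext d
    simp [hmem]
  have hpos := fun c : Cell nh => potential_nonneg hη c.width
  have h1 := Finset.sum_union_inter (s₁ := S.biUnion fun c => c.split (N c)) (s₂ := C \ S)
    (f := fun c => potential η c.width)
  have h2 : 0 ≤ ∑ c ∈ (S.biUnion fun c => c.split (N c)) ∩ (C \ S), potential η c.width :=
    Finset.sum_nonneg fun c _ => hpos c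
  have h3 := Finset.sum_biUnion_le_sum S (fun c => c.split (N c)) hpos
  have h4 := Finset.sum_sdiff hS (f := fun c => potential η c.width)
  have h5 : ∑ c ∈ S, (∑ d ∈ c.split (N c), potential η d.width + if η < c.width then 1 else 0) ≤
      ∑ c ∈ S, potential η c.width := by
    refine Finset.sum_le_sum fun c hc => ?_
    refine le_trans ?_ (mul_potential_div_add_le (w := c.width) hη
      (sub_nonneg.2 (hC c (hS hc)).le) (hN c))
    gcongr
    rw [Finset.sum_congr rfl fun d hd => by rw [width_of_mem_split hd], Finset.sum_const,
      nsmul_eq_mul]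
    exact mul_le_mul_of_nonneg_right (by exact_mod_cast card_split_le _ _)
      (potential_nonneg hη _)
  have h6 : (1 : ℝ) ≤ ∑ c ∈ S, if η < c.width then (1 : ℝ) else 0 := by
    obtain ⟨c, hc, hcη⟩ := hlarge
    refine le_trans (by rw [if_pos hcη]) (Finset.single_le_sum
      (f := fun c : Cell nh => if η < c.width then (1 : ℝ) else 0)
      (fun _ _ => by split_ifs <;> norm_num) hc)
  rw [Finset.sum_add_distrib] at h5
  rw [hC']
  linarith

theorem mid_mem_Icc {c : Cell nh} (hc : c.lo ≤ c.hi) : c.mid ∈ Icc c.lo c.hi := by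
  unfold mid
  constructor <;> linarith

end Cell

end Refinement

/-! ### Termination of the algorithm -/

namespace DynProblem

open Set

variable {nx nu nh : ℕ} {P : DynProblem nx nu nh} {A : TBParams nh}

theorem IsSubdivision.covers {C : Finset (Cell nh)} (h : P.IsSubdivision C) :
    Cell.Covers P.horizon C := by
  refine ⟨fun c hc => ⟨h.1 c hc, ?_⟩, fun i t ht => ?_⟩
  · rw [← h.2.1 c.comp]
    exact subset_iUnion₂_of_subset c (by simpa using hc) subset_rfl
  · rw [← h.2.1 i] at ht
    obtain ⟨c, hc, htc⟩ := mem_iUnion₂.1 ht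
    simp only [Finset.mem_filter] at hc
    exact ⟨c, hc.1, hc.2, htc⟩

/-- Of the formula for `numParts`, only the lower bound `2` is needed. -/
theorem isRefinement_nextCells_of_feasible {s : Iteration nu nh} (hs : P.Feasible A s)
    (hsub : s.grad ⊆ s.cells) :
    Cell.IsRefinement (P.active A s) s.cells (P.nextCells A s) := by
  refine ⟨(Finset.filter_subset _ _).trans hsub, A.numParts, fun c => le_max_left _ _, fun d => ?_⟩
  rw [nextCells, if_pos hs]
  simp

theorem isRefinement_nextCells_of_not_feasible {s : Iteration nu nh} (hs : ¬ P.Feasible A s) :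
    Cell.IsRefinement s.cells s.cells (P.nextCells A s) := by
  refine ⟨subset_rfl, fun _ => 2, fun _ => le_rfl, fun d => ?_⟩
  rw [nextCells, if_neg hs]
  simp

end DynProblem

namespace DynProblem

open Set

variable {nx nu nh : ℕ} {P : DynProblem nx nu nh} {A : TBParams nh}

/-- The path constraints are differentiable in time up to order `q` for all controls in `U`. -/
def PathChain (P : DynProblem nx nu nh) (q : ℕ) : Prop :=
  ∀ i, ∀ u ∈ P.U, ∀ m < q, ∀ t ∈ P.horizon,
    HasDerivWithinAt (P.pathDeriv i m u) (P.pathDeriv i (m + 1) u t) P.horizon t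

theorem LinearGrowth.pathChain (hgrowth : P.LinearGrowth) (htime : P.t₀ < P.tf)
    (hU : IsCompact P.U) {q : ℕ} (hf : ContDiff ℝ q fun p : Vec nx × Vec nu => P.f p.1 p.2)
    (hh : ContDiff ℝ q fun p : Vec nx × Vec nu => P.h p.1 p.2) : P.PathChain q := by
  intro i u hu m hm t ht
  obtain ⟨-, -, htr, -⟩ := hgrowth.exists_bound_traj htime.le hU
    (hf.of_le (by exact_mod_cast (by lia : 1 ≤ q)))
  exact (htr u hu).self_of_nhds.hasDerivWithinAt_pathDeriv htime hf hh i hm ht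

/-- `C` bounds, per unit of cell width, the deviation of `H_TB` (apart from the bias `δ`) and of its
gradient from the path constraint at the midpoint of a cell. -/
def ApproxConst (P : DynProblem nx nu nh) (A : TBParams nh) (C : ℝ) : Prop :=
  ∀ u ∈ P.U, ∀ c : Cell nh, c.mid ∈ P.horizon → 0 ≤ c.width → c.width ≤ 1 →
    P.HTB A u c ≤ P.path c.comp u c.mid + A.δ + C * c.width ∧
    ‖gradient (fun v => P.HTB A v c) u - gradient (fun v => P.path c.comp v c.mid) u‖ ≤ C * c.width

/-- A subdivision for which the approximation problem is infeasible contains a large cell. -/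
theorem exists_large_of_not_feasible {C η γ : ℝ} (hC : P.ApproxConst A C) (hC0 : 0 ≤ C)
    (hslater : P.SlaterMargin γ) (hη1 : η ≤ 1) (hηγ : C * η ≤ γ - A.δ) {s : Iteration nu nh}
    (hcov : Cell.Covers P.horizon s.cells) (hs : ¬ P.Feasible A s) :
    ∃ c ∈ s.cells, η < c.width := by
  by_contra! hsmall
  obtain ⟨-, us, hus, hγ⟩ := hslater
  refine hs ⟨us, hus, fun c hc => ?_⟩
  obtain ⟨hlt, hsub⟩ := hcov.1 c hc
  have hmid := hsub (Cell.mid_mem_Icc hlt.le)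
  have h1 := (hC us hus c hmid (sub_nonneg.2 hlt.le) ((hsmall c hc).trans hη1)).1
  have h2 := hγ c.comp c.mid hmid
  have h3 : C * c.width ≤ C * η := mul_le_mul_of_nonneg_left (hsmall c hc) hC0
  linarith

/-- Points that are feasible for the approximation problem are feasible for the path constraint. -/
theorem pathFeasible_of_mem_approxFeasible (hq : 1 ≤ A.q) (hr : A.q ≤ A.r + 1) (hρ : 0 < A.ρ)
    (hΛ : P.Encloses A) (hchain : P.PathChain A.q) {cells : Finset (Cell nh)}
    (hcov : Cell.Covers P.horizon cells) {u : Vec nu} (hu : u ∈ P.approxFeasible A cells) :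
    P.PathFeasible u := by
  intro i t ht
  obtain ⟨c, hc, rfl, htc⟩ := hcov.2 i t ht
  obtain ⟨hlt, hsub⟩ := hcov.1 c hc
  exact (path_le_HTB hq hr hρ hΛ hu.1 hlt hsub (hchain c.comp u hu.1) htc).trans (hu.2 c hc)

/-- If all active cells are small, the algorithm terminates. -/
theorem terminates_of_active_small (hq : 1 ≤ A.q) (hr : A.q ≤ A.r + 1) (hρ : 0 < A.ρ)
    (hΛ : P.Encloses A) (hchain : P.PathChain A.q) {C η M : ℝ} (hC : P.ApproxConst A C)
    (hC0 : 0 ≤ C) (hη0 : 0 ≤ η) (hη1 : η ≤ 1) (hηact : C * η ≤ A.εact - A.δ) (hM0 : 0 ≤ M)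
    (hηstat : nu * (M * (C * η)) ≤ A.εstat) {s : Iteration nu nh}
    (hcov : Cell.Covers P.horizon s.cells) (hs : P.Feasible A s) (hout : P.SolverOutput A s)
    (hmult : ∀ c ∈ s.grad, 0 ≤ s.mult c ∧ s.mult c ≤ M)
    (hsmall : ∀ c ∈ P.active A s, c.width ≤ η) : P.Terminates A s := by
  obtain ⟨hu, -, hsub, hcard, hkkt, hcompl⟩ := hout
  have hfeas := pathFeasible_of_mem_approxFeasible hq hr hρ hΛ hchain hcov hu
  -- A nonzero multiplier forces `H_TB = 0`, so the cell is active and narrow; zero multipliers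
  -- contribute to neither test.
  have hcell : ∀ c ∈ s.grad, s.mult c ≠ 0 → P.HTB A s.u c = 0 ∧ C * c.width ≤ C * η ∧
      P.HTB A s.u c ≤ P.path c.comp s.u c.mid + A.δ + C * c.width ∧
      ‖gradient (fun v => P.HTB A v c) s.u - gradient (fun v => P.path c.comp v c.mid) s.u‖ ≤
        C * c.width := fun c hc hne => by
    have hH := (mul_eq_zero.1 (hcompl c hc)).resolve_left hne
    have hw := hsmall c (Finset.mem_filter.2 ⟨hc, hH⟩)
    obtain ⟨hlt, hI⟩ := hcov.1 c (hsub hc)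
    exact ⟨hH, mul_le_mul_of_nonneg_left hw hC0, hC s.u hu.1 c (hI (Cell.mid_mem_Icc hlt.le))
      (sub_nonneg.2 hlt.le) (hw.trans hη1)⟩
  refine ⟨hs, ?_, fun c hc => ?_, hfeas⟩
  · have heq : gradient P.cost s.u +
        ∑ c ∈ s.grad, s.mult c • gradient (fun v => P.path c.comp v c.mid) s.u =
        -∑ c ∈ s.grad, s.mult c • (gradient (fun v => P.HTB A v c) s.u -
          gradient (fun v => P.path c.comp v c.mid) s.u) := by
      simp only [smul_sub, Finset.sum_sub_distrib]
      rw [eq_neg_of_add_eq_zero_left hkkt]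
      abel
    rw [ApproxStationary, heq, norm_neg]
    have hterm : ∀ c ∈ s.grad, ‖s.mult c • (gradient (fun v => P.HTB A v c) s.u -
        gradient (fun v => P.path c.comp v c.mid) s.u)‖ ≤ M * (C * η) := fun c hc => by
      rcases eq_or_ne (s.mult c) 0 with h0 | hne
      · rw [h0, zero_smul, norm_zero]
        positivity
      · obtain ⟨-, h1, -, h2⟩ := hcell c hc hne
        rw [norm_smul, Real.norm_of_nonneg (hmult c hc).1]
        exact mul_le_mul (hmult c hc).2 (h2.trans h1) (norm_nonneg _) hM0
    refine (norm_sum_le_of_le _ hterm).trans (le_trans ?_ hηstat)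
    rw [Finset.sum_const, nsmul_eq_mul]
    have : (s.grad.card : ℝ) ≤ nu := by exact_mod_cast hcard
    gcongr
  · rcases eq_or_ne (s.mult c) 0 with h0 | hne
    · simp [h0]
    · obtain ⟨hH, h1, h2, -⟩ := hcell c hc hne
      obtain ⟨hlt, hI⟩ := hcov.1 c (hsub hc)
      have hle := hfeas c.comp c.mid (hI (Cell.mid_mem_Icc hlt.le))
      have h0 := (hmult c hc).1
      -- From `0 = H_TB ≤ h + δ + C η` at the midpoint follows `h ≥ -εact`.
      refine ⟨?_, mul_nonpos_of_nonneg_of_nonpos h0 hle⟩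
      rw [← mul_neg]
      exact mul_le_mul_of_nonneg_left (by linarith) h0

/-- A width below which a subdivision is fine enough for all three tests. -/
theorem exists_small_width {C M α β ε : ℝ} (hC : 0 ≤ C) (hM : 0 ≤ M) (hα : 0 < α) (hβ : 0 < β)
    (hε : 0 < ε) (n : ℕ) :
    ∃ η, 0 < η ∧ η ≤ 1 ∧ C * η ≤ α ∧ C * η ≤ β ∧ n * (M * (C * η)) ≤ ε := by
  have aux : ∀ {K b η : ℝ}, 0 ≤ K → 0 < b → 0 < η → η ≤ b / (K + 1) → K * η ≤ b :=
    fun {K b η} hK hb hη h => by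
      rw [le_div_iff₀ (by positivity)] at h
      nlinarith
  have hK : 0 ≤ n * (M * C) := by positivity
  refine ⟨min 1 (min (α / (C + 1)) (min (β / (C + 1)) (ε / (n * (M * C) + 1)))), ?_,
    min_le_left _ _, ?_, ?_, ?_⟩
  · positivity
  · exact aux hC hα (by positivity) ((min_le_right _ _).trans (min_le_left _ _))
  · exact aux hC hβ (by positivity)
      ((min_le_right _ _).trans ((min_le_right _ _).trans (min_le_left _ _)))
  · rw [← mul_assoc M, ← mul_assoc]
    exact aux hK hε (by positivity)
      ((min_le_right _ _).trans ((min_le_right _ _).trans (min_le_right _ _)))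

/-- A run in which every iteration divides a cell of width more than `η` terminates. -/
theorem IsRun.exists_terminates {s : ℕ → Iteration nu nh} (hrun : P.IsRun A s) {η : ℝ} (hη : 0 < η)
    (hstep : ∀ k, P.Reached A s k → Cell.Covers P.horizon (s k).cells →
      ¬ P.Terminates A (s k) →
      ∃ S, Cell.IsRefinement S (s k).cells (P.nextCells A (s k)) ∧ ∃ c ∈ S, η < c.width) :
    ∃ K, P.Reached A s K ∧ Cell.Covers P.horizon (s K).cells ∧ P.Terminates A (s K) := by
  by_contra! hcon
  -- Without termination, `k` iterations use up at least `k` of the initial potential, which is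
  -- impossible for large `k`.
  have key : ∀ k, P.Reached A s k ∧ Cell.Covers P.horizon (s k).cells ∧
      ∑ c ∈ (s k).cells, Cell.potential η c.width + k ≤
        ∑ c ∈ (s 0).cells, Cell.potential η c.width := by
    intro k
    induction k with
    | zero => exact ⟨fun j hj => absurd hj (by lia), hrun.1.covers, by simp⟩
    | succ k ih =>
      obtain ⟨hreach, hcov, hpot⟩ := ih
      have hnot := hcon k hreach hcov
      obtain ⟨S, hS, hlarge⟩ := hstep k hreach hcov hnot
      rw [← (hrun.2 k hreach).2 hnot] at hS
      refine ⟨fun j hj => ?_, hcov.of_isRefinement hS, ?_⟩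
      · rcases Nat.lt_succ_iff_lt_or_eq.1 hj with h | rfl
        · exact hreach j h
        · exact hnot
      · have := hS.sum_potential_add_one_le (fun c hc => (hcov.1 c hc).1) hη hlarge
        push_cast
        linarith
  obtain ⟨k, hk⟩ := exists_nat_gt (∑ c ∈ (s 0).cells, Cell.potential η c.width)
  have h1 := (key k).2.2
  have h2 : 0 ≤ ∑ c ∈ (s k).cells, Cell.potential η c.width :=
    Finset.sum_nonneg fun c _ => Cell.potential_nonneg hη _
  linarith

end DynProblem

theorem theorem2 {nx nu nh : ℕ} (P : DynProblem nx nu nh) (A : TBParams nh)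
    -- standing assumptions on the problem
    (htime : P.t₀ < P.tf) (hUne : P.U.Nonempty) (hUc : IsCompact P.U)
    (hq : 1 ≤ A.q) (hr : A.q ≤ A.r + 1) (hρ : 0 < A.ρ)
    (hf : ContDiff ℝ A.q (fun p : Vec nx × Vec nu => P.f p.1 p.2))
    (hh : ContDiff ℝ A.q (fun p : Vec nx × Vec nu => P.h p.1 p.2))
    (hΦ : ContDiff ℝ 1 P.Φ)
    (hΛ : P.Encloses A)
    (hstat : 0 < A.εstat) (hact : 0 < A.εact)
    -- linear growth, Slater control, and the choice of the smoothing parameter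
    (hgrowth : P.LinearGrowth)
    (γ : ℝ) (hslater : P.SlaterMargin γ)
    (hδact : A.δ < A.εact) (hδγ : A.δ < γ)
    -- a run of the algorithm with nonnegative, uniformly bounded KKT multipliers
    (s : ℕ → Iteration nu nh) (hrun : P.IsRun A s) (hmult : P.BoundedMultipliers A s) :
    ∃ K : ℕ,
      -- the algorithm terminates in iteration `K`
      P.Reached A s K ∧ P.Terminates A (s K) ∧
      -- the returned point is feasible for the original problem
      (s K).u ∈ P.U ∧ (∀ i, ∀ t ∈ P.horizon, P.path i (s K).u t ≤ 0) ∧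
      -- approximate KKT conditions of the original problem
      ‖gradient P.cost (s K).u +
          ∑ c ∈ (s K).grad,
            (s K).mult c • gradient (fun v => P.path c.comp v c.mid) (s K).u‖ ≤ A.εstat ∧
      (∀ c ∈ (s K).grad, 0 ≤ (s K).mult c ∧
        (s K).mult c * P.path c.comp (s K).u c.mid ∈ Set.Icc (-((s K).mult c * A.εact)) 0) := by
  obtain ⟨D, hD0, hD⟩ := P.exists_pathDerivBound htime hUc hf hh hgrowth
  obtain ⟨C, hC0, hC⟩ := DynProblem.exists_HTB_sub_path_le hq hρ hD0 hD
  have hchain := hgrowth.pathChain htime hUc hf hh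
  obtain ⟨M, hM⟩ := hmult
  -- `max M 0` replaces `M`, which may be negative if no cell is ever selected.
  obtain ⟨η, hη0, hη1, hηact, hηγ, hηstat⟩ := DynProblem.exists_small_width hC0
    (le_max_right M 0) (sub_pos.2 hδact) (sub_pos.2 hδγ) hstat nu
  obtain ⟨K, hreach, hcov, hterm⟩ := hrun.exists_terminates hη0 fun k hk hcov hnot => by
    by_cases hfeas : P.Feasible A (s k)
    · have hout := (hrun.2 k hk).1 hfeas
      refine ⟨_, DynProblem.isRefinement_nextCells_of_feasible hfeas hout.2.2.1, ?_⟩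
      by_contra! hsmall
      exact hnot (DynProblem.terminates_of_active_small hq hr hρ hΛ hchain hC hC0 hη0.le hη1 hηact
        (le_max_right M 0) hηstat hcov hfeas hout
        (fun c hc => ⟨(hM k hk hfeas c hc).1, (hM k hk hfeas c hc).2.trans (le_max_left _ _)⟩)
        hsmall)
    · exact ⟨_, DynProblem.isRefinement_nextCells_of_not_feasible hfeas,
        DynProblem.exists_large_of_not_feasible hC hC0 hslater hη1 hηγ hcov hfeas⟩
  obtain ⟨hfeas, hstat', hcompl, hpath⟩ := hterm
  exact ⟨K, hreach, ⟨hfeas, hstat', hcompl, hpath⟩, ((hrun.2 K hreach).1 hfeas).1.1, hpath, hstat',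
    fun c hc => ⟨(hM K hreach hfeas c hc).1, hcompl c hc⟩⟩
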